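/- **Setting.** Let $(m_n)$ be a sequence of block lengths with $m_n\to\infty$; we write $m=m_n$, and all random variables for a given $n$ live on a common probability space. Let $\mathbb S\subset\mathbb C$ be a fixed finite constellation and $\sigma\ge 0$. Write $\mathcal{CN}(0,v)$ for the circularly symmetric complex normal law with $E|Z|^2=v$ (independent real and imaginary parts, each $N(0,v/2)$). Consider $y=Ax+\omega$ with the square $m\times m$ matrix $A=HU$, where * $H=\mathrm{diag}(h_1,\dots,h_m)$ with $h_k$ i.i.d. $\mathcal{CN}(0,1)$ (normalized Rayleigh fading), and $\omega$ has i.i.d. $\mathcal{CN}(0,\sigma^2)$ entries; * $U$ is a (deterministic or random) matrix that is almost surely unitary, with $\max_{k,j}|U_{kj}|\to 0$ in probability as $n\to\infty$ (for example all $|U_{kj}|=1/\sqrt m$); * $x$ is the transmitted vector, $\hat x$ is the initial detected vector, both with entries in $\mathbb S$, and the entries of the error $e=x-\hat x$ are independent, have zero mean and have common variance $E|e_j|^2=E\|e\|^2/m$; * for each $n$, either $E[e_j^2]=0$ for all $j$, or $U$ is almost surely the DFT matrix $\left(e^{-2\pi i kj/m}/\sqrt m\right)_{0\le k,j<m}$;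 * $U$, $e$, $H$, $\omega$ are mutually independent. Let $r=y-A\hat x$ be the residual, $\hat e=A^*r$ the estimate of $e$ in the first iteration of the thresholding decision feedback equalizer, and $z_0=\hat e-e=(A^*A-I)e+A^*\omega$ the noise in this estimate. **Theorem 1.** The entries of $z_0$ are asymptotically i.i.d. complex normal with zero mean and variance $v_n=E\|e\|^2/m+\sigma^2$. Precisely: 1. For every $n$ and every $i$, the entry $z_{i,0}$ is square integrable, $E[z_{i,0}]=0$ and $E|z_{i,0}|^2=E\|e\|^2/m+\sigma^2$. 2. For every fixed $p$ and every bounded continuous $f:\mathbb C^p\to\mathbb R$, with $Z_1,\dots,Z_p$ i.i.d. $\mathcal{CN}(0,v_n)$, $$\sup_{i_1,\dots,i_p\ \text{distinct}}\left|E f(z_{i_1,0},\dots,z_{i_p,0})-E f(Z_1,\dots,Z_p)\right|\longrightarrow 0\qquad(n\to\infty).$$ -/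

import Mathlib

open MeasureTheory ProbabilityTheory Filter
open scoped BoundedContinuousFunction Matrix Topology NNReal

namespace ThresholdingDFE

/-- The circularly symmetric complex normal law `CN(0, v)`: independent real and imaginary parts,
each of law `N(0, v/2)`, so that `E|Z|² = v` (used for `v ≥ 0`; `CN(0, 0)` is the Dirac mass). -/
noncomputable def complexGaussian (v : ℝ) : Measure ℂ :=
  ((gaussianReal 0 (v / 2).toNNReal).prod (gaussianReal 0 (v / 2).toNNReal)).map
    (fun p : ℝ × ℝ => (⟨p.1, p.2⟩ : ℂ))

theorem measurable_complexMk : Measurable (fun p : ℝ × ℝ => (⟨p.1, p.2⟩ : ℂ)) :=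
  Complex.measurableEquivRealProd.symm.measurable

instance instIsProbabilityMeasureComplexGaussian (v : ℝ) :
    IsProbabilityMeasure (complexGaussian v) :=
  Measure.isProbabilityMeasure_map measurable_complexMk.aemeasurable

/-- The unitary `m × m` discrete Fourier transform matrix. -/
noncomputable def dftMatrix (m : ℕ) : Matrix (Fin m) (Fin m) ℂ :=
  Matrix.of fun k j =>
    Complex.exp (-(2 * (Real.pi : ℂ) * Complex.I * (k : ℕ) * (j : ℕ) / (m : ℂ))) /
      ((Real.sqrt m : ℝ) : ℂ)

section Receiver

variable {m : ℕ}

/-- The system matrix `A = H U`, where `H` is the diagonal channel matrix with diagonal `h`. -/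
def systemMatrix (h : Fin m → ℂ) (U : Matrix (Fin m) (Fin m) ℂ) : Matrix (Fin m) (Fin m) ℂ :=
  Matrix.diagonal h * U

/-- The received vector `y = A x + w`. -/
def received (A : Matrix (Fin m) (Fin m) ℂ) (x w : Fin m → ℂ) : Fin m → ℂ :=
  A *ᵥ x + w

/-- The residual `r = y - A x̂`. -/
def residualVector (A : Matrix (Fin m) (Fin m) ℂ) (y xhat : Fin m → ℂ) : Fin m → ℂ :=
  y - A *ᵥ xhat

/-- The estimate `ê = A* r` of the error signal. -/
def errorEstimate (A : Matrix (Fin m) (Fin m) ℂ) (y xhat : Fin m → ℂ) : Fin m → ℂ :=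
  Aᴴ *ᵥ residualVector A y xhat

/-- The noise `z = ê - e` in the error estimate of the first iteration, where `e = x - x̂` is the
error signal and `y = H U x + w` is the received vector. -/
def noiseTerm (h : Fin m → ℂ) (U : Matrix (Fin m) (Fin m) ℂ) (x xhat w : Fin m → ℂ) :
    Fin m → ℂ :=
  errorEstimate (systemMatrix h U) (received (systemMatrix h U) x w) xhat - (x - xhat)

/-- The mean energy `E‖e‖²` (Euclidean norm) of a random vector `e`. -/
noncomputable def meanEnergy {Ω : Type*} [MeasurableSpace Ω] (P : Measure Ω)
    (e : Ω → Fin m → ℂ) : ℝ :=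
  ∫ s, ∑ j, ‖e s j‖ ^ 2 ∂P

end Receiver

/-- The entries of the random vectors `z n` (of length `M n`, possibly on different probability
spaces) are asymptotically i.i.d. `CN(0, v n)`: for every fixed `p`, the joint law of any `p`
distinct entries of `z n` and the law of `p` independent `CN(0, v n)` variables merge weakly,
uniformly in the choice of the entries. -/
def AsymptoticallyIIDComplexNormal {Ω : ℕ → Type*} [∀ n, MeasurableSpace (Ω n)]
    (P : ∀ n, Measure (Ω n)) (M : ℕ → ℕ) (z : ∀ n, Ω n → Fin (M n) → ℂ) (v : ℕ → ℝ) : Prop :=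
  ∀ (p : ℕ) (f : (Fin p → ℂ) →ᵇ ℝ) (ε : ℝ), 0 < ε →
    ∀ᶠ n in atTop, ∀ I : Fin p ↪ Fin (M n),
      |(∫ s, f (fun a => z n s (I a)) ∂(P n)) -
        ∫ c, f c ∂(Measure.pi fun _ : Fin p => complexGaussian (v n))| < ε

end ThresholdingDFE

/-! Put X = Ue. Since U is unitary, e = U*X, and the residual is HX + ω, so entry i of the noise is
the sum over k of conj(U_ki) [(|h_k|² - 1) X_k + conj(h_k) ω_k] (`noiseTerm_eq_noiseSum`). Given U
and e this is a sum of independent centred terms with small weights, and a linear functional Σ τ_a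
z_{i_a} has the same shape, with weights b_k = Σ τ_a conj(U_{k i_a}) and Σ|b_k|² = Σ|τ_a|² =: S.

No central limit theorem is invoked: the characteristic function of one term is explicit
(`integral_cexp_channelTerm`). With κ = σ²/4 and α_k = Re(b_k X_k) it is exp(-iα_k) / (1 + κ|b_k|² -
iα_k), which agrees with exp(-(κ|b_k|² + α_k²/2)) up to an error cubic in |b_k|
(`norm_cexp_div_sub_cexp_le_cube`). Given U and e, the characteristic function is therefore close to
exp(-(κS + ½ Σ α_k²)).

It remains to see that Σ α_k² concentrates at vS/2, where v is the error variance
(`integral_abs_sum_sq_sub_le`). Write α_k² = ½|b_k X_k|² + ½ Re(b_k² X_k²). Both parts are quadratic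
forms in e whose variance is of order Σ|b_k|⁴ (`integral_norm_sq_sum_centredProduct_le`). The first
sums to vS in mean. The mean of the second is a pseudo-variance, which is zero if E e_j² = 0 and
O(1/m) for the DFT matrix, where a geometric sum cancels (`norm_sum_channelWeight_sq_dftMatrix_le`).

All bounds are uniform in the chosen entries. A random U costs at most twice the probability that it
has a large entry. Lévy's continuity theorem along subsequences with convergent variance then gives
the merging of laws. The exact first and second moments come from the same decomposition. -/

namespace ThresholdingDFE

/-! ### Moments and transforms of the complex Gaussian law -/

section ComplexGaussian

theorem integral_complexGaussian {E : Type*} [NormedAddCommGroup E] [NormedSpace ℝ E] (v : ℝ)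
    (f : ℂ → E) :
    ∫ z, f z ∂(complexGaussian v) =
      ∫ p : ℝ × ℝ, f ⟨p.1, p.2⟩
        ∂((gaussianReal 0 (v / 2).toNNReal).prod (gaussianReal 0 (v / 2).toNNReal)) := by
  rw [complexGaussian]
  exact integral_map_equiv Complex.measurableEquivRealProd.symm f

theorem charFun_complexGaussian {v : ℝ} (hv : 0 ≤ v) (t : ℂ) :
    charFun (complexGaussian v) t = Complex.exp (-(v * ‖t‖ ^ 2 / 4)) := by
  have h : ∀ p : ℝ × ℝ, Complex.exp ((inner ℝ (⟨p.1, p.2⟩ : ℂ) t : ℝ) * Complex.I) =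
      Complex.exp (t.re * p.1 * Complex.I) * Complex.exp (t.im * p.2 * Complex.I) := by
    intro p
    rw [← Complex.exp_add]
    congr 1
    rw [Complex.inner]
    simp [Complex.mul_re]
    ring
  rw [charFun_apply, integral_complexGaussian]
  simp_rw [h]
  rw [integral_prod_mul (fun x : ℝ => Complex.exp (t.re * x * Complex.I))
    (fun x : ℝ => Complex.exp (t.im * x * Complex.I)), ← charFun_apply_real, ← charFun_apply_real,
    charFun_gaussianReal, charFun_gaussianReal, ← Complex.exp_add]
  congr 1
  have h2 : ((v / 2).toNNReal : ℂ) = (v : ℂ) / 2 := by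
    rw [show ((v / 2).toNNReal : ℂ) = (((v / 2).toNNReal : ℝ) : ℂ) from rfl,
      Real.coe_toNNReal _ (by positivity)]
    push_cast; rfl
  have h3 : (‖t‖ : ℂ) ^ 2 = (t.re : ℂ) ^ 2 + (t.im : ℂ) ^ 2 := by
    rw [← Complex.ofReal_pow, Complex.sq_norm, Complex.normSq_apply]; push_cast; ring
  rw [h2, h3]
  push_cast
  ring

theorem integral_sq_gaussianReal (v : ℝ≥0) : ∫ x, x ^ 2 ∂(gaussianReal 0 v) = v := by
  have h := variance_fun_id_gaussianReal (μ := 0) (v := v)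
  rwa [variance_of_integral_eq_zero aemeasurable_id' integral_id_gaussianReal] at h

theorem memLp_re_complexGaussian (v : ℝ) (q : ℝ≥0) :
    MemLp (fun p : ℝ × ℝ => p.1) q
      ((gaussianReal 0 (v / 2).toNNReal).prod (gaussianReal 0 (v / 2).toNNReal)) :=
  (memLp_id_gaussianReal q).comp_fst _

theorem memLp_im_complexGaussian (v : ℝ) (q : ℝ≥0) :
    MemLp (fun p : ℝ × ℝ => p.2) q
      ((gaussianReal 0 (v / 2).toNNReal).prod (gaussianReal 0 (v / 2).toNNReal)) :=
  (memLp_id_gaussianReal q).comp_snd _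

theorem memLp_complexGaussian (v : ℝ) (q : ℝ≥0) :
    MemLp (fun z : ℂ => z) q (complexGaussian v) := by
  rw [complexGaussian]
  refine (memLp_map_measure_iff aestronglyMeasurable_id measurable_complexMk.aemeasurable).2 ?_
  have h := (memLp_re_complexGaussian v q).norm.add (memLp_im_complexGaussian v q).norm
  refine h.of_le measurable_complexMk.aestronglyMeasurable (ae_of_all _ fun p => ?_)
  simp only [Pi.add_apply, Function.comp_apply, id]
  rw [Real.norm_of_nonneg (by positivity)]
  exact Complex.norm_le_abs_re_add_abs_im _

theorem integral_complexGaussian_id (v : ℝ) : ∫ z, z ∂(complexGaussian v) = 0 := by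
  rw [integral_complexGaussian]
  have h1 := (memLp_re_complexGaussian v 1).integrable le_rfl
  have h2 := (memLp_im_complexGaussian v 1).integrable le_rfl
  have h : ∀ p : ℝ × ℝ, (⟨p.1, p.2⟩ : ℂ) = (p.1 : ℂ) + (p.2 : ℂ) * Complex.I := fun p =>
    Complex.mk_eq_add_mul_I _ _
  simp_rw [h]
  rw [integral_add h1.ofReal (h2.ofReal.mul_const _), integral_mul_const, integral_complex_ofReal,
    integral_complex_ofReal, integral_fun_fst (fun x : ℝ => x), integral_fun_snd (fun x : ℝ => x)]
  simp

theorem integral_norm_sq_complexGaussian {v : ℝ} (hv : 0 ≤ v) :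
    ∫ z, ‖z‖ ^ 2 ∂(complexGaussian v) = v := by
  rw [integral_complexGaussian]
  have h1 := (memLp_re_complexGaussian v 2).integrable_sq
  have h2 := (memLp_im_complexGaussian v 2).integrable_sq
  have h : ∀ p : ℝ × ℝ, ‖(⟨p.1, p.2⟩ : ℂ)‖ ^ 2 = p.1 ^ 2 + p.2 ^ 2 := fun p => by
    rw [Complex.sq_norm, Complex.normSq_apply]; ring
  simp_rw [h]
  rw [integral_add h1 h2, integral_fun_fst (fun x : ℝ => x ^ 2),
    integral_fun_snd (fun x : ℝ => x ^ 2), integral_sq_gaussianReal,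
    Real.coe_toNNReal _ (by positivity)]
  simp

theorem integral_pow_four_gaussianReal_half :
    ∫ x, x ^ 4 ∂(gaussianReal 0 ((1 : ℝ) / 2).toNNReal) = 3 / 4 := by
  have hv : ((1 : ℝ) / 2).toNNReal ≠ 0 := by
    rw [Ne, Real.toNNReal_eq_zero]; norm_num
  have hpi : 0 < √Real.pi := Real.sqrt_pos.2 Real.pi_pos
  rw [integral_gaussianReal_eq_integral_smul hv]
  have h1 : ∀ x : ℝ, gaussianPDFReal 0 ((1 : ℝ) / 2).toNNReal x • x ^ 4 =
      (√Real.pi)⁻¹ * (fun y : ℝ => y ^ (4 : ℝ) * Real.exp (-1 * y ^ (2 : ℝ))) |x| := by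
    intro x
    have h4 : |x| ^ (4 : ℝ) = x ^ 4 := by
      rw [show (4 : ℝ) = ((4 : ℕ) : ℝ) by norm_num, Real.rpow_natCast, Even.pow_abs (by decide)]
    have h2 : |x| ^ (2 : ℝ) = x ^ 2 := by
      rw [show (2 : ℝ) = ((2 : ℕ) : ℝ) by norm_num, Real.rpow_natCast, sq_abs]
    simp only [h4, h2]
    rw [gaussianPDFReal, Real.coe_toNNReal _ (by norm_num), smul_eq_mul]
    rw [show 2 * Real.pi * (1 / 2) = Real.pi by ring,
      show -(x - 0) ^ 2 / (2 * (1 / 2)) = -1 * x ^ 2 by ring]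
    ring
  simp_rw [h1]
  rw [integral_const_mul,
    integral_comp_abs (f := fun y : ℝ => y ^ (4 : ℝ) * Real.exp (-1 * y ^ (2 : ℝ))),
    integral_rpow_mul_exp_neg_mul_rpow (by norm_num) (by norm_num) (by norm_num)]
  have hG : Real.Gamma ((4 + 1) / 2) = 3 / 4 * √Real.pi := by
    rw [show ((4 : ℝ) + 1) / 2 = 1 / 2 + 1 + 1 by norm_num, Real.Gamma_add_one (by norm_num),
      Real.Gamma_add_one (by norm_num), Real.Gamma_one_half_eq]
    ring
  rw [hG, Real.one_rpow]
  field_simp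

theorem integral_norm_pow_four_complexGaussian_one :
    ∫ z, ‖z‖ ^ 4 ∂(complexGaussian 1) = 2 := by
  rw [integral_complexGaussian]
  set γ := gaussianReal 0 ((1 : ℝ) / 2).toNNReal
  have i4 : Integrable (fun x : ℝ => x ^ 4) γ := by
    have h := (memLp_id_gaussianReal (μ := 0) (v := ((1 : ℝ) / 2).toNNReal) 4).integrable_norm_pow
      (p := 4) (by norm_num)
    refine h.congr (ae_of_all _ fun x => ?_)
    simp only [id, Real.norm_eq_abs]
    exact Even.pow_abs (by decide) x
  have i2 : Integrable (fun x : ℝ => x ^ 2) γ :=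
    (memLp_id_gaussianReal (μ := 0) (v := ((1 : ℝ) / 2).toNNReal) 2).integrable_sq
  have h : ∀ p : ℝ × ℝ, ‖(⟨p.1, p.2⟩ : ℂ)‖ ^ 4 = p.1 ^ 4 + 2 * (p.1 ^ 2 * p.2 ^ 2) + p.2 ^ 4 :=
    fun p => by
      rw [show ∀ r : ℝ, r ^ 4 = (r ^ 2) ^ 2 by intro r; ring, Complex.sq_norm,
        Complex.normSq_apply]; ring
  simp_rw [h]
  rw [integral_add, integral_add, integral_const_mul,
    integral_prod_mul (fun x : ℝ => x ^ 2) (fun x : ℝ => x ^ 2),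
    integral_fun_fst (fun x : ℝ => x ^ 4), integral_fun_snd (fun x : ℝ => x ^ 4),
    integral_sq_gaussianReal, integral_pow_four_gaussianReal_half,
    Real.coe_toNNReal _ (by positivity)]
  · simp; norm_num
  · exact i4.comp_fst _
  · exact (i2.mul_prod i2).const_mul 2
  · exact (i4.comp_fst _).add ((i2.mul_prod i2).const_mul 2)
  · exact i4.comp_snd _

/-- The integral itself is (1 + l)^(-1/2); squaring removes the branch of the root, and the square
is what the planar integral needs. -/
theorem integral_cexp_neg_mul_sq_gaussianReal_half {l : ℂ} (hl : 0 ≤ l.re) :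
    (∫ x : ℝ, Complex.exp (-l * x ^ 2) ∂(gaussianReal 0 ((1 : ℝ) / 2).toNNReal)) ^ 2 =
      1 / (1 + l) := by
  have hv : ((1 : ℝ) / 2).toNNReal ≠ 0 := by
    rw [Ne, Real.toNNReal_eq_zero]; norm_num
  have hpi : 0 < √Real.pi := Real.sqrt_pos.2 Real.pi_pos
  rw [integral_gaussianReal_eq_integral_smul hv]
  have h1 : ∀ x : ℝ, gaussianPDFReal 0 ((1 : ℝ) / 2).toNNReal x • Complex.exp (-l * x ^ 2) =
      ((√Real.pi)⁻¹ : ℝ) * Complex.exp (-(1 + l) * x ^ 2) := by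
    intro x
    rw [gaussianPDFReal, Real.coe_toNNReal _ (by norm_num), Complex.real_smul]
    rw [show 2 * Real.pi * (1 / 2) = Real.pi by ring,
      show -(x - 0) ^ 2 / (2 * (1 / 2)) = -1 * x ^ 2 by ring]
    rw [Complex.ofReal_mul, mul_assoc, Complex.ofReal_exp, ← Complex.exp_add]
    push_cast
    ring_nf
  simp_rw [h1]
  rw [integral_const_mul, integral_gaussian_complex (by simp; linarith), mul_pow,
    ← Complex.cpow_nat_mul]
  have h2 : (((√Real.pi)⁻¹ : ℝ) : ℂ) ^ 2 = 1 / (Real.pi : ℂ) := by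
    rw [← Complex.ofReal_pow, inv_pow, Real.sq_sqrt Real.pi_pos.le]; simp
  have h3 : (1 + l) ≠ 0 := fun h => by
    have := congrArg Complex.re h; simp at this; linarith
  have h4 : (Real.pi : ℂ) ≠ 0 := by exact_mod_cast Real.pi_ne_zero
  rw [h2]
  norm_num
  field_simp

/-- Under `CN(0, 1)` the squared modulus is exponential with mean one; this is its Laplace
transform. -/
theorem integral_cexp_neg_mul_norm_sq_complexGaussian {l : ℂ} (hl : 0 ≤ l.re) :
    ∫ z, Complex.exp (-l * ‖z‖ ^ 2) ∂(complexGaussian 1) = 1 / (1 + l) := by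
  rw [integral_complexGaussian, ← integral_cexp_neg_mul_sq_gaussianReal_half hl, sq,
    ← integral_prod_mul]
  congr 1
  ext p
  rw [← Complex.exp_add, ← Complex.ofReal_pow, Complex.sq_norm, Complex.normSq_apply]
  congr 1
  push_cast
  ring

/-- The joint law of a channel coefficient and an entry of the noise. -/
noncomputable def channelNoise (σ : ℝ) : Measure (ℂ × ℂ) :=
  (complexGaussian 1).prod (complexGaussian (σ ^ 2))

instance (σ : ℝ) : IsProbabilityMeasure (channelNoise σ) := by
  unfold channelNoise; infer_instance

/-- The contribution of one channel use to an entry of the noise term. -/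
noncomputable def channelTerm (a c : ℂ) (g : ℂ × ℂ) : ℂ :=
  a * ((‖g.1‖ ^ 2 - 1 : ℝ) : ℂ) + c * (starRingEnd ℂ g.1 * g.2)

theorem continuous_channelTerm (a c : ℂ) : Continuous (channelTerm a c) := by
  unfold channelTerm; fun_prop

/-- Given the channel coefficient h, the term is affine in the Gaussian noise. Integrating the noise
out leaves exp(-i Re a) exp(-l|h|²) with l = σ²|c|²/4 - i Re a, and the Laplace transform of |h|²
finishes. -/
theorem integral_cexp_channelTerm (σ : ℝ) (a c : ℂ) :
    ∫ g, Complex.exp ((channelTerm a c g).re * Complex.I) ∂(channelNoise σ) =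
      Complex.exp (-(a.re * Complex.I)) /
        (1 + ((σ ^ 2 * ‖c‖ ^ 2 / 4 : ℝ) - a.re * Complex.I)) := by
  have hint : Integrable (fun g => Complex.exp ((channelTerm a c g).re * Complex.I))
      (channelNoise σ) := by
    refine Integrable.of_bound (C := 1) ?_ (ae_of_all _ fun g => ?_)
    · refine Continuous.aestronglyMeasurable ?_
      have := continuous_channelTerm a c
      fun_prop
    · rw [Complex.norm_exp_ofReal_mul_I]
  rw [channelNoise] at hint ⊢
  rw [integral_prod _ hint]
  have hin : ∀ h : ℂ, ∫ w, Complex.exp ((channelTerm a c (h, w)).re * Complex.I)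
      ∂(complexGaussian (σ ^ 2)) =
      Complex.exp (-(a.re * Complex.I)) *
        Complex.exp (-((σ ^ 2 * ‖c‖ ^ 2 / 4 : ℝ) - a.re * Complex.I) * ‖h‖ ^ 2) := by
    intro h
    have hw : ∀ w : ℂ, Complex.exp ((channelTerm a c (h, w)).re * Complex.I) =
        Complex.exp (a.re * (‖h‖ ^ 2 - 1 : ℝ) * Complex.I) *
          Complex.exp ((inner ℝ w (starRingEnd ℂ c * h) : ℝ) * Complex.I) := by
      intro w
      rw [← Complex.exp_add]
      congr 1
      rw [← add_mul]
      congr 1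
      rw [← Complex.ofReal_mul, ← Complex.ofReal_add]
      congr 1
      simp [channelTerm, Complex.inner, -map_mul, Complex.mul_re, Complex.mul_im]
      simp only [← Complex.ofReal_pow, Complex.ofReal_re, Complex.ofReal_im]
      ring
    simp_rw [hw]
    rw [integral_const_mul, ← charFun_apply, charFun_complexGaussian (sq_nonneg σ),
      ← Complex.exp_add, ← Complex.exp_add]
    congr 1
    rw [norm_mul, RCLike.norm_conj]
    push_cast
    ring
  simp_rw [hin]
  rw [integral_const_mul, integral_cexp_neg_mul_norm_sq_complexGaussian]
  · ring
  · simp only [Complex.sub_re, Complex.mul_re, Complex.ofReal_re, Complex.I_re, Complex.ofReal_im,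
      Complex.I_im]
    have : 0 ≤ σ ^ 2 * ‖c‖ ^ 2 / 4 := by positivity
    linarith

theorem integrable_norm_pow_complexGaussian (v : ℝ) (k : ℕ) :
    Integrable (fun z : ℂ => ‖z‖ ^ k) (complexGaussian v) :=
  MemLp.integrable_norm_pow' (by exact_mod_cast memLp_complexGaussian v k)

/-- The value one is the reason why the interference enters the final variance as exactly the error
variance. -/
theorem integral_sq_norm_sq_sub_one_complexGaussian :
    ∫ z, (‖z‖ ^ 2 - 1) ^ 2 ∂(complexGaussian 1) = 1 := by
  have h : ∀ z : ℂ, (‖z‖ ^ 2 - 1) ^ 2 = ‖z‖ ^ 4 - 2 * ‖z‖ ^ 2 + 1 := fun z => by ring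
  simp_rw [h]
  have i4 := integrable_norm_pow_complexGaussian 1 4
  have i2 := (integrable_norm_pow_complexGaussian 1 2).const_mul 2
  have i42 : Integrable (fun z : ℂ => ‖z‖ ^ 4 - 2 * ‖z‖ ^ 2) (complexGaussian 1) := i4.sub i2
  rw [integral_add i42 (integrable_const _), integral_sub i4 i2, integral_const_mul,
    integral_norm_pow_four_complexGaussian_one, integral_norm_sq_complexGaussian zero_le_one]
  simp

theorem memLp_norm_sq_sub_one_complexGaussian :
    MemLp (fun z : ℂ => ((‖z‖ ^ 2 - 1 : ℝ) : ℂ)) 2 (complexGaussian 1) := by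
  suffices H : MemLp (fun z : ℂ => ‖z‖ ^ 2 - 1) 2 (complexGaussian 1) from H.ofReal
  rw [memLp_two_iff_integrable_sq (by fun_prop)]
  have h : ∀ z : ℂ, (‖z‖ ^ 2 - 1) ^ 2 = ‖z‖ ^ 4 - 2 * ‖z‖ ^ 2 + 1 := fun z => by ring
  simp_rw [h]
  exact ((integrable_norm_pow_complexGaussian 1 4).sub
    ((integrable_norm_pow_complexGaussian 1 2).const_mul 2)).add (integrable_const _)

theorem memLp_conj_mul_channelNoise (σ : ℝ) :
    MemLp (fun g : ℂ × ℂ => starRingEnd ℂ g.1 * g.2) 2 (channelNoise σ) := by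
  rw [memLp_two_iff_integrable_sq_norm (by fun_prop)]
  have h := (integrable_norm_pow_complexGaussian 1 2).mul_prod
    (integrable_norm_pow_complexGaussian (σ ^ 2) 2)
  refine h.congr (ae_of_all _ fun g => ?_)
  simp only [norm_mul, RCLike.norm_conj, mul_pow]

theorem memLp_channelTerm (σ : ℝ) (a c : ℂ) : MemLp (channelTerm a c) 2 (channelNoise σ) :=
  ((memLp_norm_sq_sub_one_complexGaussian.comp_fst _).const_mul a).add
    ((memLp_conj_mul_channelNoise σ).const_mul c)

theorem integral_channelTerm (σ : ℝ) (a c : ℂ) :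
    ∫ g, channelTerm a c g ∂(channelNoise σ) = 0 := by
  have h1 := ((memLp_norm_sq_sub_one_complexGaussian.comp_fst
    (complexGaussian (σ ^ 2))).integrable one_le_two)
  have h2 := (memLp_conj_mul_channelNoise σ).integrable one_le_two
  simp only [channelTerm, channelNoise] at *
  rw [integral_add (h1.const_mul a) (h2.const_mul c), integral_const_mul, integral_const_mul,
    integral_prod_mul (fun h => starRingEnd ℂ h) (fun w => w), integral_complexGaussian_id,
    integral_fun_fst (fun h : ℂ => ((‖h‖ ^ 2 - 1 : ℝ) : ℂ)), integral_complex_ofReal,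
    integral_sub (integrable_norm_pow_complexGaussian 1 2) (integrable_const _),
    integral_norm_sq_complexGaussian zero_le_one]
  simp

/-- The cross term is linear in the additive noise, which is centred and independent of the channel
coefficient, so the two second moments add. -/
theorem integral_norm_sq_channelTerm (σ : ℝ) (a c : ℂ) :
    ∫ g, ‖channelTerm a c g‖ ^ 2 ∂(channelNoise σ) = ‖a‖ ^ 2 + σ ^ 2 * ‖c‖ ^ 2 := by
  have hu := memLp_norm_sq_sub_one_complexGaussian.comp_fst (complexGaussian (σ ^ 2))
  have hw := memLp_conj_mul_channelNoise σ
  have i1 : Integrable (fun g : ℂ × ℂ => (‖g.1‖ ^ 2 - 1) ^ 2) (channelNoise σ) := by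
    refine ((memLp_two_iff_integrable_sq_norm hu.1).1 hu).congr (ae_of_all _ fun g => ?_)
    simp only [Complex.norm_real, Real.norm_eq_abs, sq_abs]
  have i2 := (memLp_two_iff_integrable_sq_norm hw.1).1 hw
  have i3 : Integrable (fun g : ℂ × ℂ => ((‖g.1‖ ^ 2 - 1 : ℝ) : ℂ) * (starRingEnd ℂ g.1 * g.2))
      (channelNoise σ) := MemLp.integrable_mul hu hw
  have i4 : Integrable (fun g : ℂ × ℂ => 2 * (starRingEnd ℂ a * c *
      (((‖g.1‖ ^ 2 - 1 : ℝ) : ℂ) * (starRingEnd ℂ g.1 * g.2))).re) (channelNoise σ) :=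
    ((i3.const_mul (starRingEnd ℂ a * c)).re).const_mul 2
  have h : ∀ g : ℂ × ℂ, ‖channelTerm a c g‖ ^ 2 = ‖a‖ ^ 2 * (‖g.1‖ ^ 2 - 1) ^ 2 +
      2 * (starRingEnd ℂ a * c * (((‖g.1‖ ^ 2 - 1 : ℝ) : ℂ) * (starRingEnd ℂ g.1 * g.2))).re +
      ‖c‖ ^ 2 * ‖starRingEnd ℂ g.1 * g.2‖ ^ 2 := by
    intro g
    rw [channelTerm]
    generalize ‖g.1‖ ^ 2 - 1 = r
    generalize starRingEnd ℂ g.1 * g.2 = z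
    simp only [Complex.sq_norm, Complex.normSq_apply, Complex.mul_re, Complex.mul_im,
      Complex.add_re, Complex.add_im, Complex.ofReal_re, Complex.ofReal_im, Complex.conj_re,
      Complex.conj_im]
    ring
  simp_rw [h]
  have e1 : ∫ g : ℂ × ℂ, (‖g.1‖ ^ 2 - 1) ^ 2 ∂(channelNoise σ) = 1 := by
    rw [channelNoise, integral_fun_fst (fun h : ℂ => (‖h‖ ^ 2 - 1) ^ 2),
      integral_sq_norm_sq_sub_one_complexGaussian]
    simp
  have e2 : ∫ g : ℂ × ℂ, ‖starRingEnd ℂ g.1 * g.2‖ ^ 2 ∂(channelNoise σ) = σ ^ 2 := by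
    simp only [norm_mul, RCLike.norm_conj, mul_pow]
    rw [channelNoise, integral_prod_mul (fun h : ℂ => ‖h‖ ^ 2) (fun w : ℂ => ‖w‖ ^ 2),
      integral_norm_sq_complexGaussian zero_le_one, integral_norm_sq_complexGaussian (sq_nonneg σ),
      one_mul]
  have e3 : ∫ g : ℂ × ℂ, ((‖g.1‖ ^ 2 - 1 : ℝ) : ℂ) * (starRingEnd ℂ g.1 * g.2)
      ∂(channelNoise σ) = 0 := by
    simp_rw [← mul_assoc]
    rw [channelNoise, integral_prod_mul (fun h : ℂ => ((‖h‖ ^ 2 - 1 : ℝ) : ℂ) * starRingEnd ℂ h)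
      (fun w : ℂ => w), integral_complexGaussian_id, mul_zero]
  have e4 : ∫ g : ℂ × ℂ, (starRingEnd ℂ a * c *
      (((‖g.1‖ ^ 2 - 1 : ℝ) : ℂ) * (starRingEnd ℂ g.1 * g.2))).re ∂(channelNoise σ) = 0 := by
    have := integral_re (i3.const_mul (starRingEnd ℂ a * c))
    simp only [RCLike.re_to_complex] at this
    rw [this, integral_const_mul, e3, mul_zero, Complex.zero_re]
  have i14 : Integrable (fun g : ℂ × ℂ => ‖a‖ ^ 2 * (‖g.1‖ ^ 2 - 1) ^ 2 +
      2 * (starRingEnd ℂ a * c * (((‖g.1‖ ^ 2 - 1 : ℝ) : ℂ) * (starRingEnd ℂ g.1 * g.2))).re)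
      (channelNoise σ) := (i1.const_mul _).add i4
  rw [integral_add i14 (i2.const_mul _), integral_add (i1.const_mul _) i4,
    integral_const_mul, integral_const_mul, integral_const_mul, e1, e2, e4]
  ring

end ComplexGaussian

/-! ### Second-order expansion of one characteristic function factor -/

section Expansion

/-- Telescoping: factors are exchanged one at a time, the others having modulus at most one. -/
theorem norm_prod_sub_prod_le {ι : Type*} (s : Finset ι) (a c : ι → ℂ) (ha : ∀ i, ‖a i‖ ≤ 1)
    (hc : ∀ i, ‖c i‖ ≤ 1) : ‖∏ i ∈ s, a i - ∏ i ∈ s, c i‖ ≤ ∑ i ∈ s, ‖a i - c i‖ := by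
  classical
  induction s using Finset.induction_on with
  | empty => simp
  | insert j s hj ih =>
    rw [Finset.prod_insert hj, Finset.prod_insert hj, Finset.sum_insert hj]
    have h1 : ‖∏ i ∈ s, a i‖ ≤ 1 := by
      rw [norm_prod]; exact Finset.prod_le_one (fun _ _ => norm_nonneg _) fun i _ => ha i
    calc ‖a j * ∏ i ∈ s, a i - c j * ∏ i ∈ s, c i‖
        = ‖(a j - c j) * ∏ i ∈ s, a i + c j * (∏ i ∈ s, a i - ∏ i ∈ s, c i)‖ := by ring_nf
      _ ≤ ‖a j - c j‖ * 1 + 1 * ∑ i ∈ s, ‖a i - c i‖ := by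
        refine (norm_add_le _ _).trans ?_
        rw [norm_mul, norm_mul]
        gcongr
        exact hc j
      _ = _ := by ring

theorem one_le_norm_one_add {s : ℝ} (hs : 0 ≤ s) (x : ℝ) :
    1 ≤ ‖1 + ((s : ℂ) - x * Complex.I)‖ := by
  refine le_trans ?_ (Complex.re_le_norm _)
  simp [hs]

theorem norm_cexp_div_le_one {s : ℝ} (hs : 0 ≤ s) (x : ℝ) :
    ‖Complex.exp (-(x * Complex.I)) / (1 + ((s : ℂ) - x * Complex.I))‖ ≤ 1 := by
  rw [norm_div, div_le_one (lt_of_lt_of_le one_pos (one_le_norm_one_add hs x))]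
  have : ‖Complex.exp (-(x * Complex.I))‖ = 1 := by
    rw [show -((x : ℂ) * Complex.I) = ((-x : ℝ) : ℂ) * Complex.I by push_cast; ring,
      Complex.norm_exp_ofReal_mul_I]
  rw [this]
  exact one_le_norm_one_add hs x

theorem norm_cexp_neg_le_one {r : ℝ} (hr : 0 ≤ r) : ‖Complex.exp (-(r : ℂ))‖ ≤ 1 := by
  rw [← Complex.ofReal_neg, Complex.norm_exp_ofReal]
  exact Real.exp_le_one_iff.2 (neg_nonpos.2 hr)

/-- With w = s - ix the first expression is e^(-s) e^w / (1 + w), and e^w / (1 + w) = 1 + w²/2 +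
O(|w|³). Here w² = -x² + (s² - 2isx): the term -x² matches e^(-x²/2) to this order, and the bracket
accounts for s² + s|x|. -/
theorem norm_cexp_div_sub_cexp_le {s : ℝ} (hs : 0 ≤ s) (x : ℝ) :
    ‖Complex.exp (-(x * Complex.I)) / (1 + ((s : ℂ) - x * Complex.I)) -
      Complex.exp (-((s + x ^ 2 / 2 : ℝ) : ℂ))‖ ≤ 2 * (s + |x|) ^ 3 + s ^ 2 + s * |x| := by
  set w : ℂ := (s : ℂ) - x * Complex.I with hw
  have hwn : ‖w‖ ≤ s + |x| := by
    refine (norm_sub_le _ _).trans ?_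
    simp [abs_of_nonneg hs]
  have hxw : |x| ≤ ‖w‖ := by
    have := Complex.abs_im_le_norm w
    simpa [hw] using this
  have h1w := one_le_norm_one_add hs x
  rw [← hw] at h1w
  have hx := abs_nonneg x
  -- For large w both expressions have modulus at most one, while 2(s + |x|)³ is at least 2.
  by_cases hle : 1 < ‖w‖
  · have h1 := norm_cexp_div_le_one hs x
    have h2 : ‖Complex.exp (-((s + x ^ 2 / 2 : ℝ) : ℂ))‖ ≤ 1 := norm_cexp_neg_le_one (by positivity)
    have h3 : 1 ≤ (s + |x|) ^ 3 := one_le_pow₀ (hle.le.trans hwn)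
    have h4 : 0 ≤ s * |x| := by positivity
    refine (norm_sub_le _ _).trans ?_
    nlinarith [sq_nonneg s]
  · push Not at hle
    have hne : 1 + w ≠ 0 := by
      intro h; rw [h, norm_zero] at h1w; linarith
    set r := Complex.exp w - 1 - w - w ^ 2 / 2 with hr
    have hrb : ‖r‖ ≤ ‖w‖ ^ 3 * (1 / 4) := by
      have := Complex.exp_bound hle (n := 3) (by norm_num)
      simp only [Finset.sum_range_succ, Finset.sum_range_zero] at this
      norm_num [Nat.factorial] at this
      have h3 : 0 ≤ ‖w‖ ^ 3 := by positivity
      refine le_trans (le_of_eq ?_) (this.trans (by linarith))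
      rw [hr]; congr 1; ring
    have hx1 : |x| ≤ 1 := hxw.trans hle
    set q : ℝ := Real.exp (-(x ^ 2 / 2)) - 1 - (-(x ^ 2 / 2)) with hq
    have hqb : |q| ≤ ‖w‖ ^ 3 * (1 / 4) := by
      have hx2 : x ^ 2 ≤ 1 := by rw [← sq_abs]; exact pow_le_one₀ hx hx1
      have h := Real.abs_exp_sub_one_sub_id_le (x := -(x ^ 2 / 2)) (by
        rw [abs_neg, abs_of_nonneg (by positivity)]; linarith)
      refine h.trans ?_
      have h4 : |x| ^ 4 ≤ ‖w‖ ^ 3 := by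
        calc |x| ^ 4 = |x| ^ 3 * |x| := by ring
          _ ≤ ‖w‖ ^ 3 * 1 := by gcongr
          _ = _ := mul_one _
      have h5 : (-(x ^ 2 / 2)) ^ 2 = |x| ^ 4 * (1 / 4) := by
        rw [Even.pow_abs (by decide)]; ring
      rw [h5]; linarith
    have hes : ‖Complex.exp (-(s : ℂ))‖ ≤ 1 := norm_cexp_neg_le_one hs
    have key : Complex.exp (-(x * Complex.I)) / (1 + w) -
        Complex.exp (-((s + x ^ 2 / 2 : ℝ) : ℂ)) = Complex.exp (-(s : ℂ)) *
        ((r - w ^ 3 / 2) / (1 + w) + ((s ^ 2 : ℝ) - (2 * s * x : ℝ) * Complex.I) / 2 - (q : ℂ)) := by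
      have e1 : Complex.exp (-(x * Complex.I)) = Complex.exp (-(s : ℂ)) * Complex.exp w := by
        rw [← Complex.exp_add, hw]; congr 1; ring
      have e2 : Complex.exp (-((s + x ^ 2 / 2 : ℝ) : ℂ)) =
          Complex.exp (-(s : ℂ)) * (q + 1 - x ^ 2 / 2 : ℝ) := by
        rw [hq, show Real.exp (-(x ^ 2 / 2)) - 1 - -(x ^ 2 / 2) + 1 - x ^ 2 / 2 =
          Real.exp (-(x ^ 2 / 2)) by ring, Complex.ofReal_exp, ← Complex.exp_add]
        congr 1; push_cast; ring
      have e3 : Complex.exp w = r + 1 + w + w ^ 2 / 2 := by rw [hr]; ring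
      have e4 : ((s ^ 2 : ℝ) : ℂ) - (2 * s * x : ℝ) * Complex.I = w ^ 2 + (x : ℂ) ^ 2 := by
        rw [hw]; push_cast; linear_combination (-(x : ℂ) ^ 2) * Complex.I_sq
      rw [e1, e2, e3, e4]
      push_cast
      field_simp
      ring
    rw [key, norm_mul]
    have b1 : ‖(r - w ^ 3 / 2) / (1 + w)‖ ≤ ‖w‖ ^ 3 * (3 / 4) := by
      rw [norm_div]
      refine (div_le_self (norm_nonneg _) h1w).trans ((norm_sub_le _ _).trans ?_)
      rw [norm_div, norm_pow, Complex.norm_two]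
      linarith
    have b2 : ‖(((s ^ 2 : ℝ) : ℂ) - (2 * s * x : ℝ) * Complex.I) / 2‖ ≤ s ^ 2 + s * |x| := by
      rw [norm_div, Complex.norm_two]
      have := norm_sub_le ((s ^ 2 : ℝ) : ℂ) ((2 * s * x : ℝ) * Complex.I)
      rw [norm_mul, Complex.norm_I, mul_one, Complex.norm_real, Complex.norm_real,
        Real.norm_of_nonneg (sq_nonneg s), Real.norm_eq_abs, abs_mul, abs_mul, abs_two,
        abs_of_nonneg hs] at this
      have := sq_nonneg s
      linarith
    have b3 : ‖(q : ℂ)‖ ≤ ‖w‖ ^ 3 * (1 / 4) := by rwa [Complex.norm_real]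
    have b4 : ‖w‖ ^ 3 ≤ (s + |x|) ^ 3 := by gcongr
    have b5 : 0 ≤ ‖w‖ ^ 3 := by positivity
    refine (mul_le_of_le_one_left (norm_nonneg _) hes).trans ?_
    refine (norm_sub_le _ _).trans ((add_le_add_left (norm_add_le _ _) _).trans ?_)
    linarith

/-- The characteristic function error of one channel use, in terms of the size `x` of the error
signal seen through it and of the size `β` of its weight. -/
theorem norm_cexp_div_sub_cexp_le_cube {κ β T x α : ℝ} (hκ : 0 ≤ κ) (hβ : 0 ≤ β) (hT : β ≤ T)
    (hα : |α| ≤ β * x) :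
    ‖Complex.exp (-(α * Complex.I)) / (1 + (((κ * β ^ 2 : ℝ) : ℂ) - α * Complex.I)) -
      Complex.exp (-((κ * β ^ 2 + α ^ 2 / 2 : ℝ) : ℂ))‖ ≤
      (8 + 8 * κ ^ 3 * T ^ 3 + κ ^ 2 * T + κ) * β ^ 3 * (1 + x ^ 4) := by
  refine (norm_cexp_div_sub_cexp_le (by positivity) α).trans ?_
  have ha := abs_nonneg α
  -- Convexity of the cube: 4(a³ + b³) - (a + b)³ = 3(a + b)(a - b)².
  have h1 : (κ * β ^ 2 + |α|) ^ 3 ≤ 4 * (κ * β ^ 2) ^ 3 + 4 * |α| ^ 3 := by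
    have hp : 0 ≤ κ * β ^ 2 := by positivity
    nlinarith [mul_nonneg (add_nonneg hp ha) (sq_nonneg (κ * β ^ 2 - |α|))]
  have h2 : |α| ^ 3 ≤ β ^ 3 * x ^ 3 := by rw [← mul_pow]; gcongr
  have h3 : (κ * β ^ 2) ^ 3 ≤ β ^ 3 * (κ ^ 3 * T ^ 3) := by
    calc (κ * β ^ 2) ^ 3 = β ^ 3 * (κ ^ 3 * β ^ 3) := by ring
      _ ≤ _ := by gcongr
  have h4 : (κ * β ^ 2) ^ 2 ≤ β ^ 3 * (κ ^ 2 * T) := by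
    calc (κ * β ^ 2) ^ 2 = β ^ 3 * (κ ^ 2 * β) := by ring
      _ ≤ _ := by gcongr
  have h5 : κ * β ^ 2 * |α| ≤ β ^ 3 * (κ * x) := by
    calc κ * β ^ 2 * |α| ≤ κ * β ^ 2 * (β * x) := by gcongr
      _ = _ := by ring
  -- All powers of x are absorbed into 1 + x⁴, because a fourth moment bound will be available.
  have h6 : x ^ 3 ≤ 1 + x ^ 4 := by
    nlinarith [sq_nonneg (x ^ 2 - x), sq_nonneg (x - 1), sq_nonneg (x + 1), sq_nonneg x,
      sq_nonneg (x ^ 2 - 1)]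
  have h7 : x ≤ 1 + x ^ 4 := by nlinarith [sq_nonneg (x ^ 2 - 1), sq_nonneg (x - 1)]
  have h8 : (1 : ℝ) ≤ 1 + x ^ 4 := by nlinarith [sq_nonneg (x ^ 2)]
  have hb3 : 0 ≤ β ^ 3 := by positivity
  have hT0 : 0 ≤ T := hβ.trans hT
  calc 2 * (κ * β ^ 2 + |α|) ^ 3 + (κ * β ^ 2) ^ 2 + κ * β ^ 2 * |α|
      ≤ β ^ 3 * (8 * (κ ^ 3 * T ^ 3) * 1 + 8 * x ^ 3 + κ ^ 2 * T * 1 + κ * x) := by nlinarith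
    _ ≤ β ^ 3 * (8 * (κ ^ 3 * T ^ 3) * (1 + x ^ 4) + 8 * (1 + x ^ 4) + κ ^ 2 * T * (1 + x ^ 4) +
        κ * (1 + x ^ 4)) := by gcongr
    _ = _ := by ring

end Expansion

/-! ### Variance of quadratic forms in independent variables -/

section QuadraticForm

variable {Ω ι : Type*} [MeasurableSpace Ω] {P : Measure Ω}
  {Y : ι → Ω → ℂ}

/-- An index that occurs in only one factor is independent of the rest, so its zero mean factors
out. The indices b, c, d may coincide. -/
theorem integral_mul_eq_zero_of_ne (hY : iIndepFun Y P) (hm : ∀ j, Measurable (Y j))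
    {F : ℂ → ℂ} (hF : Measurable F) {G : ℂ × ℂ × ℂ → ℂ} (hG : Measurable G) {a b c d : ι}
    (hb : a ≠ b) (hc : a ≠ c) (hd : a ≠ d) (h0 : ∫ s, F (Y a s) ∂P = 0) :
    ∫ s, F (Y a s) * G (Y b s, Y c s, Y d s) ∂P = 0 := by
  classical
  have hdis : Disjoint ({a} : Finset ι) {b, c, d} := by
    simp [hb, hc, hd]
  have hind := hY.indepFun_finset {a} {b, c, d} hdis hm
  have hind' : IndepFun (Y a) (fun s => (Y b s, Y c s, Y d s)) P :=
    hind.comp (φ := fun x : (({a} : Finset ι) → ℂ) => x ⟨a, by simp⟩)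
      (ψ := fun x : (({b, c, d} : Finset ι) → ℂ) =>
        (x ⟨b, by simp⟩, x ⟨c, by simp⟩, x ⟨d, by simp⟩))
      (measurable_pi_apply _) (by fun_prop)
  rw [hind'.integral_fun_comp_mul_comp (hm a).aemeasurable (by fun_prop)
    hF.aestronglyMeasurable hG.aestronglyMeasurable, h0, zero_mul]

variable {f g : ℂ → ℂ}

/-- The centred product `f (Y j) * g (Y l)`. -/
noncomputable def centredProduct (P : Measure Ω) (Y : ι → Ω → ℂ) (f g : ℂ → ℂ) (j l : ι)
    (s : Ω) : ℂ :=
  f (Y j s) * g (Y l s) - ∫ t, f (Y j t) * g (Y l t) ∂P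

theorem measurable_centredProduct (hm : ∀ j, Measurable (Y j)) (hf : Measurable f)
    (hg : Measurable g) (j l : ι) : Measurable (centredProduct P Y f g j l) := by
  have := hm j
  have := hm l
  unfold centredProduct
  fun_prop

theorem ae_norm_product_le {C : ℝ} (hfC : ∀ᵐ s ∂P, ∀ j, ‖f (Y j s)‖ ≤ C)
    (hgC : ∀ᵐ s ∂P, ∀ j, ‖g (Y j s)‖ ≤ C) :
    ∀ᵐ s ∂P, ∀ j l, ‖f (Y j s) * g (Y l s)‖ ≤ C ^ 2 := by
  filter_upwards [hfC, hgC] with s h1 h2 j l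
  rw [norm_mul, sq]
  exact mul_le_mul (h1 j) (h2 l) (norm_nonneg _) ((norm_nonneg _).trans (h1 j))

theorem integral_product_eq_zero (hY : iIndepFun Y P) (hm : ∀ j, Measurable (Y j))
    (hf : Measurable f) (hg : Measurable g) (hf0 : ∀ j, ∫ s, f (Y j s) ∂P = 0) {j l : ι}
    (hjl : j ≠ l) : ∫ s, f (Y j s) * g (Y l s) ∂P = 0 :=
  integral_mul_eq_zero_of_ne hY hm hf (G := fun x => g x.1) (by fun_prop) hjl hjl hjl (hf0 j)

variable [IsProbabilityMeasure P]

theorem ae_norm_centredProduct_le {C : ℝ} (hfC : ∀ᵐ s ∂P, ∀ j, ‖f (Y j s)‖ ≤ C)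
    (hgC : ∀ᵐ s ∂P, ∀ j, ‖g (Y j s)‖ ≤ C) :
    ∀ᵐ s ∂P, ∀ j l, ‖centredProduct P Y f g j l s‖ ≤ 2 * C ^ 2 := by
  have h := ae_norm_product_le hfC hgC
  have hi : ∀ j l, ‖∫ t, f (Y j t) * g (Y l t) ∂P‖ ≤ C ^ 2 := fun j l => by
    refine (norm_integral_le_of_norm_le_const (h.mono fun s hs => hs j l)).trans ?_
    simp
  filter_upwards [h] with s hs j l
  refine (norm_sub_le _ _).trans ?_
  linarith [hs j l, hi j l]

theorem integrable_product (hm : ∀ j, Measurable (Y j)) (hf : Measurable f) (hg : Measurable g)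
    {C : ℝ} (hfC : ∀ᵐ s ∂P, ∀ j, ‖f (Y j s)‖ ≤ C) (hgC : ∀ᵐ s ∂P, ∀ j, ‖g (Y j s)‖ ≤ C)
    (j l : ι) : Integrable (fun s => f (Y j s) * g (Y l s)) P := by
  have := hm j
  have := hm l
  exact Integrable.of_bound (by fun_prop) (C ^ 2)
    ((ae_norm_product_le hfC hgC).mono fun s hs => hs j l)

/-- If j = l, both products are diagonal with different indices, hence independent and centred. If j
≠ l, the centring is zero, and since the pairs differ as unordered pairs, j or l is absent from the
second one. The case j = l, j' ≠ l' is left out here; exchanging the pairs and conjugating reduces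
it to this one. -/
theorem integral_centredProduct_mul_eq_zero_of_notMem (hY : iIndepFun Y P)
    (hm : ∀ j, Measurable (Y j)) (hf : Measurable f) (hg : Measurable g)
    (hf0 : ∀ j, ∫ s, f (Y j s) ∂P = 0) (hg0 : ∀ j, ∫ s, g (Y j s) ∂P = 0) {C : ℝ}
    (hfC : ∀ᵐ s ∂P, ∀ j, ‖f (Y j s)‖ ≤ C) (hgC : ∀ᵐ s ∂P, ∀ j, ‖g (Y j s)‖ ≤ C) {j l j' l' : ι}
    (h : ¬ ((j' = j ∧ l' = l) ∨ (j' = l ∧ l' = j)) ∧ (j ≠ l ∨ j' = l')) :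
    ∫ s, centredProduct P Y f g j l s * starRingEnd ℂ (centredProduct P Y f g j' l' s) ∂P = 0 := by
  have hconj : Measurable (starRingEnd ℂ : ℂ → ℂ) := Complex.continuous_conj.measurable
  obtain ⟨h1, h2⟩ := h
  by_cases hjl : j = l
  · subst hjl
    have hjl' : j' = l' := by tauto
    subst hjl'
    have hne : j ≠ j' := by rintro rfl; tauto
    refine integral_mul_eq_zero_of_ne hY hm
      (F := fun z => f z * g z - ∫ t, f (Y j t) * g (Y j t) ∂P)
      (G := fun x => starRingEnd ℂ (f x.1 * g x.1 - ∫ t, f (Y j' t) * g (Y j' t) ∂P))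
      (by fun_prop) (by fun_prop) hne hne hne ?_
    rw [integral_sub (integrable_product hm hf hg hfC hgC j j) (integrable_const _)]
    simp
  · have hc : ∀ s, centredProduct P Y f g j l s = f (Y j s) * g (Y l s) := fun s => by
      rw [centredProduct, integral_product_eq_zero hY hm hf hg hf0 hjl, sub_zero]
    simp_rw [hc]
    by_cases hj : j = j' ∨ j = l'
    · have hl : l ≠ j' ∧ l ≠ l' := by
        constructor
        · rintro rfl; rcases hj with rfl | rfl <;> tauto
        · rintro rfl; rcases hj with rfl | rfl <;> tauto
      simp_rw [mul_comm (f _) (g _), mul_assoc]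
      exact integral_mul_eq_zero_of_ne hY hm hg (G := fun x => f x.1 * starRingEnd ℂ
        (f x.2.1 * g x.2.2 - ∫ t, f (Y j' t) * g (Y l' t) ∂P)) (by fun_prop) (Ne.symm hjl) hl.1 hl.2
        (hg0 l)
    · push Not at hj
      simp_rw [mul_assoc]
      exact integral_mul_eq_zero_of_ne hY hm hf (G := fun x => g x.1 * starRingEnd ℂ
        (f x.2.1 * g x.2.2 - ∫ t, f (Y j' t) * g (Y l' t) ∂P)) (by fun_prop) hjl hj.1 hj.2 (hf0 j)

theorem integral_centredProduct_mul_eq_zero (hY : iIndepFun Y P)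
    (hm : ∀ j, Measurable (Y j)) (hf : Measurable f) (hg : Measurable g)
    (hf0 : ∀ j, ∫ s, f (Y j s) ∂P = 0) (hg0 : ∀ j, ∫ s, g (Y j s) ∂P = 0) {C : ℝ}
    (hfC : ∀ᵐ s ∂P, ∀ j, ‖f (Y j s)‖ ≤ C) (hgC : ∀ᵐ s ∂P, ∀ j, ‖g (Y j s)‖ ≤ C) {j l j' l' : ι}
    (h : ¬ ((j' = j ∧ l' = l) ∨ (j' = l ∧ l' = j))) :
    ∫ s, centredProduct P Y f g j l s * starRingEnd ℂ (centredProduct P Y f g j' l' s) ∂P = 0 := by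
  by_cases hc : j ≠ l ∨ j' = l'
  · exact integral_centredProduct_mul_eq_zero_of_notMem hY hm hf hg hf0 hg0 hfC hgC ⟨h, hc⟩
  · have hsw := integral_centredProduct_mul_eq_zero_of_notMem hY hm hf hg hf0 hg0 hfC hgC
      (j := j') (l := l') (j' := j) (l' := l) ⟨by tauto, by tauto⟩
    rw [← map_zero (starRingEnd ℂ), ← hsw, ← integral_conj]
    simp only [map_mul, Complex.conj_conj, mul_comm]

/-- When the square is expanded, a pair correlates only with itself and its transpose. Each
surviving covariance is at most (2C²)², and the transposed terms are handled by the
arithmetic-geometric mean inequality, so the bound sees only the Hilbert-Schmidt norm of Q. -/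
theorem integral_norm_sq_sum_centredProduct_le [Fintype ι] (hY : iIndepFun Y P)
    (hm : ∀ j, Measurable (Y j)) (hf : Measurable f) (hg : Measurable g)
    (hf0 : ∀ j, ∫ s, f (Y j s) ∂P = 0) (hg0 : ∀ j, ∫ s, g (Y j s) ∂P = 0) {C : ℝ}
    (hfC : ∀ᵐ s ∂P, ∀ j, ‖f (Y j s)‖ ≤ C) (hgC : ∀ᵐ s ∂P, ∀ j, ‖g (Y j s)‖ ≤ C) (Q : ι → ι → ℂ) :
    ∫ s, ‖∑ j, ∑ l, Q j l * centredProduct P Y f g j l s‖ ^ 2 ∂P ≤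
      8 * C ^ 4 * ∑ j, ∑ l, ‖Q j l‖ ^ 2 := by
  classical
  set D : ι × ι → Ω → ℂ := fun p => centredProduct P Y f g p.1 p.2 with hD
  set q : ι × ι → ℂ := fun p => Q p.1 p.2 with hq
  have hDm : ∀ p, Measurable (D p) := fun p => measurable_centredProduct hm hf hg p.1 p.2
  have hDb : ∀ᵐ s ∂P, ∀ p, ‖D p s‖ ≤ 2 * C ^ 2 :=
    (ae_norm_centredProduct_le hfC hgC).mono fun s hs p => hs p.1 p.2
  have hconj : Measurable (starRingEnd ℂ : ℂ → ℂ) := Complex.continuous_conj.measurable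
  have hDDb : ∀ p r, ∀ᵐ s ∂P, ‖D p s * starRingEnd ℂ (D r s)‖ ≤ 4 * C ^ 4 := fun p r => by
    filter_upwards [hDb] with s hs
    rw [norm_mul, RCLike.norm_conj]
    calc ‖D p s‖ * ‖D r s‖ ≤ (2 * C ^ 2) * (2 * C ^ 2) := by
          gcongr
          exacts [hs p, hs r]
      _ = _ := by ring
  have hDDi : ∀ p r, Integrable (fun s => D p s * starRingEnd ℂ (D r s)) P := fun p r => by
    have := hDm p
    have := hDm r
    exact Integrable.of_bound (by fun_prop) _ (hDDb p r)
  have hDDn : ∀ p r, ‖∫ s, D p s * starRingEnd ℂ (D r s) ∂P‖ ≤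
      4 * C ^ 4 * ((if r = p then 1 else 0) + (if r = p.swap then 1 else 0)) := fun p r => by
    by_cases h : (r.1 = p.1 ∧ r.2 = p.2) ∨ (r.1 = p.2 ∧ r.2 = p.1)
    · have h1 : ‖∫ s, D p s * starRingEnd ℂ (D r s) ∂P‖ ≤ 4 * C ^ 4 := by
        refine (norm_integral_le_of_norm_le_const (hDDb p r)).trans ?_
        simp
      -- An inequality only: for a diagonal pair both indicators equal one.
      have h2 : (1 : ℝ) ≤ (if r = p then 1 else 0) + (if r = p.swap then 1 else 0) := by
        rcases h with h | h
        · rw [if_pos (Prod.ext h.1 h.2)]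
          split_ifs <;> norm_num
        · rw [if_pos (show r = p.swap from Prod.ext h.1 h.2)]
          split_ifs <;> norm_num
      have h3 : 0 ≤ 4 * C ^ 4 := by positivity
      nlinarith
    · have : ∫ s, D p s * starRingEnd ℂ (D r s) ∂P = 0 :=
        integral_centredProduct_mul_eq_zero hY hm hf hg hf0 hg0 hfC hgC h
      rw [this, norm_zero]
      positivity
  have hsum : ∀ s, ∑ j, ∑ l, Q j l * centredProduct P Y f g j l s = ∑ p, q p * D p s := fun s => by
    rw [Fintype.sum_prod_type]
  have hexp : ((∫ s, ‖∑ j, ∑ l, Q j l * centredProduct P Y f g j l s‖ ^ 2 ∂P : ℝ) : ℂ) =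
      ∑ p, ∑ r, q p * starRingEnd ℂ (q r) * ∫ s, D p s * starRingEnd ℂ (D r s) ∂P := by
    rw [← integral_complex_ofReal]
    simp_rw [hsum]
    have : ∀ s, ((‖∑ p, q p * D p s‖ ^ 2 : ℝ) : ℂ) =
        ∑ p, ∑ r, q p * starRingEnd ℂ (q r) * (D p s * starRingEnd ℂ (D r s)) := fun s => by
      rw [Complex.ofReal_pow, ← Complex.mul_conj', map_sum, Finset.sum_mul_sum]
      refine Finset.sum_congr rfl fun p _ => Finset.sum_congr rfl fun r _ => ?_
      rw [map_mul]; ring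
    simp_rw [this]
    rw [integral_finsetSum _ fun p _ => integrable_finsetSum _ fun r _ => (hDDi p r).const_mul _]
    refine Finset.sum_congr rfl fun p _ => ?_
    rw [integral_finsetSum _ fun r _ => (hDDi p r).const_mul _]
    exact Finset.sum_congr rfl fun r _ => integral_const_mul _ _
  have h0 : 0 ≤ ∫ s, ‖∑ j, ∑ l, Q j l * centredProduct P Y f g j l s‖ ^ 2 ∂P :=
    integral_nonneg fun s => by positivity
  rw [← Real.norm_of_nonneg h0, ← Complex.norm_real, hexp]
  have hswap : ∑ p : ι × ι, ‖q p.swap‖ ^ 2 = ∑ p, ‖q p‖ ^ 2 :=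
    Equiv.sum_comp (Equiv.prodComm ι ι) fun p => ‖q p‖ ^ 2
  calc ‖∑ p, ∑ r, q p * starRingEnd ℂ (q r) * ∫ s, D p s * starRingEnd ℂ (D r s) ∂P‖
      ≤ ∑ p, ∑ r, ‖q p‖ * ‖q r‖ *
        (4 * C ^ 4 * ((if r = p then 1 else 0) + (if r = p.swap then 1 else 0))) := by
        refine (norm_sum_le _ _).trans (Finset.sum_le_sum fun p _ => (norm_sum_le _ _).trans
          (Finset.sum_le_sum fun r _ => ?_))
        rw [norm_mul, norm_mul, RCLike.norm_conj]
        gcongr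
        exact hDDn p r
    _ = ∑ p, 4 * C ^ 4 * (‖q p‖ * ‖q p‖ + ‖q p‖ * ‖q p.swap‖) := by
        refine Finset.sum_congr rfl fun p _ => ?_
        simp only [mul_add, Finset.sum_add_distrib, mul_ite, mul_one, mul_zero, Finset.sum_ite_eq',
          Finset.mem_univ, if_true]
        ring
    _ ≤ ∑ p, 4 * C ^ 4 * (‖q p‖ ^ 2 + (‖q p‖ ^ 2 + ‖q p.swap‖ ^ 2) / 2) := by
        gcongr with p
        · exact (sq _).ge
        · nlinarith [sq_nonneg (‖q p‖ - ‖q p.swap‖)]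
    _ = 8 * C ^ 4 * ∑ p, ‖q p‖ ^ 2 := by
        rw [← Finset.mul_sum, Finset.sum_add_distrib, ← Finset.sum_div, Finset.sum_add_distrib,
          hswap]
        ring
    _ = _ := by rw [Fintype.sum_prod_type]

end QuadraticForm

/-! ### Parseval identities for unitary matrices -/

section Unitary

variable {ι : Type*} {U : Matrix ι ι ℂ}

/-- The weights with which the channel uses enter a linear functional of the noise term. -/
noncomputable def channelWeight (U : Matrix ι ι ℂ) {p : ℕ} (I : Fin p ↪ ι) (τ : Fin p → ℂ)
    (k : ι) : ℂ :=
  ∑ a, τ a * starRingEnd ℂ (U k (I a))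

theorem norm_channelWeight_le {p : ℕ} (I : Fin p ↪ ι) (τ : Fin p → ℂ) {δ : ℝ}
    (hδ : ∀ k j, ‖U k j‖ ≤ δ) (k : ι) : ‖channelWeight U I τ k‖ ≤ (∑ a, ‖τ a‖) * δ := by
  rw [channelWeight, Finset.sum_mul]
  refine (norm_sum_le _ _).trans (Finset.sum_le_sum fun a _ => ?_)
  rw [norm_mul, RCLike.norm_conj]
  gcongr
  exact hδ _ _

variable [Fintype ι]

theorem ofReal_norm_sq_sum (a : ι → ℂ) :
    ((‖∑ k, a k‖ ^ 2 : ℝ) : ℂ) = ∑ k, ∑ k', a k * starRingEnd ℂ (a k') := by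
  rw [Complex.ofReal_pow, ← Complex.mul_conj', map_sum, Finset.sum_mul_sum]

variable [DecidableEq ι]

theorem sum_row_mul_conj_row (hU : U ∈ Matrix.unitaryGroup ι ℂ) (k k' : ι) :
    ∑ j, U k j * starRingEnd ℂ (U k' j) = if k = k' then 1 else 0 := by
  have h := congrFun (congrFun (Matrix.mem_unitaryGroup_iff.1 hU) k) k'
  rw [Matrix.mul_apply, Matrix.one_apply] at h
  simpa [Matrix.star_apply] using h

theorem sum_conj_col_mul_col (hU : U ∈ Matrix.unitaryGroup ι ℂ) (j l : ι) :
    ∑ k, starRingEnd ℂ (U k j) * U k l = if j = l then 1 else 0 := by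
  have h := congrFun (congrFun (Matrix.mem_unitaryGroup_iff'.1 hU) j) l
  rw [Matrix.mul_apply, Matrix.one_apply] at h
  simpa [Matrix.star_apply] using h

theorem sum_norm_sq_row (hU : U ∈ Matrix.unitaryGroup ι ℂ) (k : ι) : ∑ j, ‖U k j‖ ^ 2 = 1 := by
  have h := sum_row_mul_conj_row hU k k
  simp only [Complex.mul_conj', if_true] at h
  exact_mod_cast h

theorem sum_norm_sq_col (hU : U ∈ Matrix.unitaryGroup ι ℂ) (j : ι) : ∑ k, ‖U k j‖ ^ 2 = 1 := by
  have h := sum_conj_col_mul_col hU j j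
  simp only [mul_comm (starRingEnd ℂ _), Complex.mul_conj', if_true] at h
  exact_mod_cast h

theorem norm_entry_le_one (hU : U ∈ Matrix.unitaryGroup ι ℂ) (k j : ι) : ‖U k j‖ ≤ 1 :=
  entry_norm_bound_of_unitary hU k j

theorem sum_norm_sq_sum_mul (hU : U ∈ Matrix.unitaryGroup ι ℂ) (a : ι → ℂ) :
    ∑ l, ‖∑ k, a k * U k l‖ ^ 2 = ∑ k, ‖a k‖ ^ 2 := by
  have h : ((∑ l, ‖∑ k, a k * U k l‖ ^ 2 : ℝ) : ℂ) = ((∑ k, ‖a k‖ ^ 2 : ℝ) : ℂ) := by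
    rw [Complex.ofReal_sum]
    simp_rw [ofReal_norm_sq_sum]
    rw [Finset.sum_comm]
    rw [Complex.ofReal_sum]
    refine Finset.sum_congr rfl fun k _ => ?_
    rw [Finset.sum_comm]
    have : ∀ k', ∑ l, a k * U k l * starRingEnd ℂ (a k' * U k' l) =
        if k = k' then a k * starRingEnd ℂ (a k') else 0 := fun k' => by
      have := sum_row_mul_conj_row hU k k'
      calc ∑ l, a k * U k l * starRingEnd ℂ (a k' * U k' l)
          = a k * starRingEnd ℂ (a k') * ∑ l, U k l * starRingEnd ℂ (U k' l) := by
            rw [Finset.mul_sum]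
            refine Finset.sum_congr rfl fun l _ => ?_
            rw [map_mul]; ring
        _ = _ := by rw [this]; simp
    simp_rw [this]
    rw [Finset.sum_ite_eq, if_pos (Finset.mem_univ _), Complex.mul_conj', Complex.ofReal_pow]
  exact_mod_cast h

/-- This is the Hilbert-Schmidt norm of the kernel of a quadratic form in e. Only the moduli of p
matter, so that p can be U (for X_k²) or its conjugate (for |X_k|²). -/
theorem sum_sum_norm_sq_sum_mul (hU : U ∈ Matrix.unitaryGroup ι ℂ) (d : ι → ℂ) {p : ι → ι → ℂ}
    (hp : ∀ k j, ‖p k j‖ = ‖U k j‖) :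
    ∑ j, ∑ l, ‖∑ k, d k * p k j * U k l‖ ^ 2 = ∑ k, ‖d k‖ ^ 2 := by
  simp_rw [fun j => sum_norm_sq_sum_mul hU fun k => d k * p k j]
  rw [Finset.sum_comm]
  refine Finset.sum_congr rfl fun k _ => ?_
  simp_rw [norm_mul, mul_pow, hp]
  rw [← Finset.mul_sum, sum_norm_sq_row hU, mul_one]

/-- Distinct columns of U are orthogonal. Here injectivity of I enters, and with it the asymptotic
independence of distinct entries. -/
theorem sum_norm_sq_channelWeight (hU : U ∈ Matrix.unitaryGroup ι ℂ) {p : ℕ} (I : Fin p ↪ ι)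
    (τ : Fin p → ℂ) : ∑ k, ‖channelWeight U I τ k‖ ^ 2 = ∑ a, ‖τ a‖ ^ 2 := by
  have h : ((∑ k, ‖channelWeight U I τ k‖ ^ 2 : ℝ) : ℂ) = ((∑ a, ‖τ a‖ ^ 2 : ℝ) : ℂ) := by
    rw [Complex.ofReal_sum, Complex.ofReal_sum]
    simp_rw [channelWeight, ofReal_norm_sq_sum]
    rw [Finset.sum_comm]
    refine Finset.sum_congr rfl fun a _ => ?_
    rw [Finset.sum_comm]
    have : ∀ b, ∑ k, τ a * starRingEnd ℂ (U k (I a)) *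
        starRingEnd ℂ (τ b * starRingEnd ℂ (U k (I b))) =
        if a = b then τ a * starRingEnd ℂ (τ b) else 0 := fun b => by
      have := sum_conj_col_mul_col hU (I a) (I b)
      calc _ = τ a * starRingEnd ℂ (τ b) * ∑ k, starRingEnd ℂ (U k (I a)) * U k (I b) := by
            rw [Finset.mul_sum]
            refine Finset.sum_congr rfl fun l _ => ?_
            rw [map_mul, Complex.conj_conj]; ring
        _ = _ := by rw [this]; simp [I.injective.eq_iff]
    simp_rw [this]
    rw [Finset.sum_ite_eq, if_pos (Finset.mem_univ _), Complex.mul_conj', Complex.ofReal_pow]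
  exact_mod_cast h

end Unitary

/-! ### Concentration of quadratic statistics of the error signal -/

section ErrorFamily

variable {Ω ι : Type*} [MeasurableSpace Ω]

/-- Independent centred bounded complex random variables with common variance `v`. -/
structure IsErrorFamily (P : Measure Ω) (Y : ι → Ω → ℂ) (C v : ℝ) : Prop where
  indep : iIndepFun Y P
  meas : ∀ j, Measurable (Y j)
  bound : ∀ᵐ s ∂P, ∀ j, ‖Y j s‖ ≤ C
  mean : ∀ j, ∫ s, Y j s ∂P = 0
  var : ∀ j, ∫ s, ‖Y j s‖ ^ 2 ∂P = v

namespace IsErrorFamily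

variable {P : Measure Ω} {Y : ι → Ω → ℂ} {C v : ℝ}

theorem ae_norm_conj_le (h : IsErrorFamily P Y C v) :
    ∀ᵐ s ∂P, ∀ j, ‖starRingEnd ℂ (Y j s)‖ ≤ C := by
  filter_upwards [h.bound] with s hs j
  rw [RCLike.norm_conj]; exact hs j

theorem integral_conj (h : IsErrorFamily P Y C v) (j : ι) :
    ∫ s, starRingEnd ℂ (Y j s) ∂P = 0 := by
  rw [_root_.integral_conj, h.mean, map_zero]

theorem var_le_sq [IsProbabilityMeasure P] [Nonempty ι] (h : IsErrorFamily P Y C v) : v ≤ C ^ 2 := by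
  obtain ⟨j⟩ := ‹Nonempty ι›
  rw [← h.var j]
  have h1 : ∀ᵐ s ∂P, ‖‖Y j s‖ ^ 2‖ ≤ C ^ 2 := h.bound.mono fun s hs => by
    rw [Real.norm_of_nonneg (by positivity)]
    exact pow_le_pow_left₀ (norm_nonneg _) (hs j) 2
  refine (le_abs_self _).trans ((norm_integral_le_of_norm_le_const h1).trans ?_)
  simp

theorem var_nonneg [Nonempty ι] (h : IsErrorFamily P Y C v) : 0 ≤ v := by
  obtain ⟨j⟩ := ‹Nonempty ι›
  rw [← h.var j]
  exact integral_nonneg fun s => by positivity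

theorem norm_integral_sq_le [IsProbabilityMeasure P] (h : IsErrorFamily P Y C v) (j : ι) :
    ‖∫ s, Y j s * Y j s ∂P‖ ≤ C ^ 2 := by
  refine (norm_integral_le_of_norm_le_const (C := C ^ 2) ?_).trans (by simp)
  exact (ae_norm_product_le (f := id) (g := id) h.bound h.bound).mono fun s hs => hs j j

variable [Fintype ι]

theorem measurable_sum (h : IsErrorFamily P Y C v) (c : ι → ℂ) :
    Measurable fun s => ∑ j, c j * Y j s :=
  Finset.measurable_sum _ fun j _ => (h.meas j).const_mul _

theorem ae_norm_sum_le (h : IsErrorFamily P Y C v) (c : ι → ℂ) :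
    ∀ᵐ s ∂P, ‖∑ j, c j * Y j s‖ ≤ (∑ j, ‖c j‖) * C := by
  filter_upwards [h.bound] with s hs
  rw [Finset.sum_mul]
  refine (norm_sum_le _ _).trans (Finset.sum_le_sum fun j _ => ?_)
  rw [norm_mul]
  gcongr
  exact hs j

variable [IsProbabilityMeasure P]

theorem integrable_norm_pow_sum (h : IsErrorFamily P Y C v) (c : ι → ℂ) (n : ℕ) :
    Integrable (fun s => ‖∑ j, c j * Y j s‖ ^ n) P := by
  have hm := h.measurable_sum c
  refine Integrable.of_bound (hm.norm.pow_const n).aestronglyMeasurable (((∑ j, ‖c j‖) * C) ^ n) ?_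
  filter_upwards [h.ae_norm_sum_le c] with s hs
  rw [Real.norm_of_nonneg (by positivity)]
  gcongr

theorem integral_norm_sq_sum (h : IsErrorFamily P Y C v) (c : ι → ℂ) :
    ∫ s, ‖∑ j, c j * Y j s‖ ^ 2 ∂P = (∑ j, ‖c j‖ ^ 2) * v := by
  classical
  have hconj : Measurable (starRingEnd ℂ : ℂ → ℂ) := Complex.continuous_conj.measurable
  have hint : ∀ j l, Integrable (fun s => Y j s * starRingEnd ℂ (Y l s)) P := fun j l =>
    integrable_product (f := id) h.meas measurable_id hconj h.bound h.ae_norm_conj_le j l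
  have hval : ∀ j l, ∫ s, Y j s * starRingEnd ℂ (Y l s) ∂P = if j = l then (v : ℂ) else 0 := by
    intro j l
    split_ifs with hjl
    · subst hjl
      simp_rw [Complex.mul_conj', ← Complex.ofReal_pow]
      rw [integral_complex_ofReal, h.var]
    · exact integral_product_eq_zero (f := id) h.indep h.meas measurable_id hconj h.mean hjl
  have key : ((∫ s, ‖∑ j, c j * Y j s‖ ^ 2 ∂P : ℝ) : ℂ) = (((∑ j, ‖c j‖ ^ 2) * v : ℝ) : ℂ) := by
    rw [← integral_complex_ofReal]
    have : ∀ s, ((‖∑ j, c j * Y j s‖ ^ 2 : ℝ) : ℂ) =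
        ∑ j, ∑ l, c j * starRingEnd ℂ (c l) * (Y j s * starRingEnd ℂ (Y l s)) := fun s => by
      rw [ofReal_norm_sq_sum]
      refine Finset.sum_congr rfl fun p _ => Finset.sum_congr rfl fun r _ => ?_
      rw [map_mul]; ring
    simp_rw [this]
    rw [integral_finsetSum _ fun p _ => integrable_finsetSum _ fun r _ => (hint p r).const_mul _]
    rw [Complex.ofReal_mul, Complex.ofReal_sum, Finset.sum_mul]
    refine Finset.sum_congr rfl fun j _ => ?_
    rw [integral_finsetSum _ fun r _ => (hint j r).const_mul _]
    simp_rw [integral_const_mul, hval]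
    simp [Complex.mul_conj']
  exact_mod_cast key

variable [DecidableEq ι] {U : Matrix ι ι ℂ}

/-- The form is a double sum over the entries of e; the subtracted constant is its mean, to which
only diagonal products contribute. With f the conjugation or the identity it covers |X_k|² and X_k².
-/
theorem integral_norm_sq_quadratic_sub_le (h : IsErrorFamily P Y C v)
    (hU : U ∈ Matrix.unitaryGroup ι ℂ) (d : ι → ℂ) {p : ι → ι → ℂ}
    (hp : ∀ k j, ‖p k j‖ = ‖U k j‖) {f : ℂ → ℂ} (hf : Measurable f)
    (hf0 : ∀ j, ∫ s, f (Y j s) ∂P = 0) (hfC : ∀ᵐ s ∂P, ∀ j, ‖f (Y j s)‖ ≤ C) :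
    ∫ s, ‖∑ k, d k * ((∑ j, p k j * f (Y j s)) * ∑ l, U k l * Y l s) -
      ∑ k, d k * ∑ j, p k j * U k j * ∫ t, f (Y j t) * Y j t ∂P‖ ^ 2 ∂P ≤
      8 * C ^ 4 * ∑ k, ‖d k‖ ^ 2 := by
  have hQ := integral_norm_sq_sum_centredProduct_le (g := id) h.indep h.meas hf measurable_id hf0
    h.mean hfC h.bound (fun j l => ∑ k, d k * p k j * U k l)
  rw [sum_sum_norm_sq_sum_mul hU d hp] at hQ
  refine le_trans (le_of_eq ?_) hQ
  congr 1
  ext s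
  congr 2
  simp only [centredProduct, mul_sub, Finset.sum_sub_distrib, id]
  congr 1
  · simp_rw [Finset.sum_mul_sum, Finset.mul_sum, Finset.sum_mul]
    rw [Finset.sum_comm]
    refine Finset.sum_congr rfl fun j _ => ?_
    rw [Finset.sum_comm]
    refine Finset.sum_congr rfl fun l _ => Finset.sum_congr rfl fun k _ => ?_
    ring
  · simp_rw [Finset.mul_sum]
    rw [Finset.sum_comm]
    refine Finset.sum_congr rfl fun j _ => ?_
    refine ((Finset.sum_eq_single j (fun l _ hl => ?_) (by simp)).trans ?_).symm
    · have : ∫ s, f (Y j s) * Y l s ∂P = 0 := integral_product_eq_zero (g := id) h.indep h.meas hf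
        measurable_id hf0 (Ne.symm hl)
      rw [this, mul_zero]
    · rw [Finset.sum_mul]
      refine Finset.sum_congr rfl fun k _ => ?_
      ring

theorem integral_norm_sq_sum_mul_norm_sq_sub_le (h : IsErrorFamily P Y C v)
    (hU : U ∈ Matrix.unitaryGroup ι ℂ) (d : ι → ℂ) :
    ∫ s, ‖∑ k, d k * ((‖∑ j, U k j * Y j s‖ ^ 2 : ℝ) : ℂ) - ∑ k, d k * v‖ ^ 2 ∂P ≤
      8 * C ^ 4 * ∑ k, ‖d k‖ ^ 2 := by
  have hconj : Measurable (starRingEnd ℂ : ℂ → ℂ) := Complex.continuous_conj.measurable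
  have hq := h.integral_norm_sq_quadratic_sub_le hU d (p := fun k j => starRingEnd ℂ (U k j))
    (fun k j => RCLike.norm_conj _) hconj h.integral_conj h.ae_norm_conj_le
  refine le_trans (le_of_eq ?_) hq
  congr 1
  ext s
  congr 3
  · refine Finset.sum_congr rfl fun k _ => ?_
    have : ∑ j, starRingEnd ℂ (U k j) * starRingEnd ℂ (Y j s) =
        starRingEnd ℂ (∑ j, U k j * Y j s) := by
      rw [map_sum]; simp only [map_mul]
    rw [this, Complex.conj_mul', Complex.ofReal_pow]
  · refine Finset.sum_congr rfl fun k _ => ?_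
    have h1 : ∀ j, ∫ t, starRingEnd ℂ (Y j t) * Y j t ∂P = v := fun j => by
      simp_rw [Complex.conj_mul', ← Complex.ofReal_pow]
      rw [integral_complex_ofReal, h.var]
    have h2 : ∑ j, starRingEnd ℂ (U k j) * U k j = 1 := by
      simp_rw [Complex.conj_mul']
      exact_mod_cast sum_norm_sq_row hU k
    simp_rw [h1]
    rw [← Finset.sum_mul, h2, one_mul]

/-- Concentrating d on the single index k bounds the variance of |X_k|² by 8C⁴. Then y² ≤ 2(y - v)²
+ 2v² and v ≤ C² give 18 = 2·8 + 2. -/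
theorem integral_norm_pow_four_le (h : IsErrorFamily P Y C v)
    (hU : U ∈ Matrix.unitaryGroup ι ℂ) (k : ι) :
    ∫ s, ‖∑ j, U k j * Y j s‖ ^ 4 ∂P ≤ 18 * C ^ 4 := by
  have hne : Nonempty ι := ⟨k⟩
  have hq := h.integral_norm_sq_sum_mul_norm_sq_sub_le hU (fun i => if i = k then 1 else 0)
  have hd : ∑ i, ‖(if i = k then 1 else 0 : ℂ)‖ ^ 2 = 1 := by
    rw [Finset.sum_eq_single k] <;> simp +contextual
  rw [hd] at hq
  simp only [ite_mul, one_mul, zero_mul, Finset.sum_ite_eq', Finset.mem_univ, if_true] at hq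
  simp_rw [← Complex.ofReal_sub, Complex.norm_real, Real.norm_eq_abs, sq_abs] at hq
  have hi : Integrable (fun s => (‖∑ j, U k j * Y j s‖ ^ 2 - v) ^ 2) P := by
    have h4 := h.integrable_norm_pow_sum (U k) 4
    have h2 := (h.integrable_norm_pow_sum (U k) 2).const_mul (2 * v)
    refine ((h4.sub h2).add (integrable_const (v ^ 2))).congr (ae_of_all _ fun s => ?_)
    simp only [Pi.add_apply, Pi.sub_apply]
    ring
  have hv : v ^ 2 ≤ C ^ 4 := by
    calc v ^ 2 ≤ (C ^ 2) ^ 2 := pow_le_pow_left₀ h.var_nonneg h.var_le_sq 2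
      _ = _ := by ring
  calc ∫ s, ‖∑ j, U k j * Y j s‖ ^ 4 ∂P
      ≤ ∫ s, (2 * (‖∑ j, U k j * Y j s‖ ^ 2 - v) ^ 2 + 2 * v ^ 2) ∂P := by
        refine integral_mono (h.integrable_norm_pow_sum (U k) 4)
          ((hi.const_mul 2).add (integrable_const _)) fun s => ?_
        simp only
        nlinarith [sq_nonneg (‖∑ j, U k j * Y j s‖ ^ 2 - 2 * v)]
    _ = 2 * (∫ s, (‖∑ j, U k j * Y j s‖ ^ 2 - v) ^ 2 ∂P) + 2 * v ^ 2 := by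
        rw [integral_add (hi.const_mul 2) (integrable_const _), integral_const_mul]
        simp
    _ ≤ _ := by linarith

theorem integral_norm_le_sqrt {F : Ω → ℂ} (hF : AEStronglyMeasurable F P) {K B : ℝ}
    (hK : ∀ᵐ s ∂P, ‖F s‖ ≤ K) (hB : ∫ s, ‖F s‖ ^ 2 ∂P ≤ B) : ∫ s, ‖F s‖ ∂P ≤ √B := by
  refine Real.le_sqrt_of_sq_le (le_trans ?_ hB)
  have hm : MemLp (fun s => ‖F s‖) 2 P := (MemLp.of_bound hF K hK).norm
  have := variance_nonneg (fun s => ‖F s‖) P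
  rw [variance_eq_sub hm] at this
  simpa using this

/-- The conditional variance of a linear functional of the noise term concentrates. -/
theorem integral_abs_sum_sq_sub_le (h : IsErrorFamily P Y C v)
    (hU : U ∈ Matrix.unitaryGroup ι ℂ) (b : ι → ℂ) {R : ℝ}
    (hR : ‖∑ k, b k ^ 2 * ∑ j, U k j * U k j * ∫ t, Y j t * Y j t ∂P‖ ≤ R) :
    ∫ s, |∑ k, (b k * ∑ j, U k j * Y j s).re ^ 2 - v / 2 * ∑ k, ‖b k‖ ^ 2| ∂P ≤
      √(8 * C ^ 4 * ∑ k, ‖b k‖ ^ 4) + R / 2 := by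
  set X : ι → Ω → ℂ := fun k s => ∑ j, U k j * Y j s with hX
  have hXm : ∀ k, Measurable (X k) := fun k => h.measurable_sum (U k)
  have hXb : ∀ᵐ s ∂P, ∀ k, ‖X k s‖ ≤ (∑ j, ‖U k j‖) * C :=
    ae_all_iff.2 fun k => h.ae_norm_sum_le (U k)
  -- Since (Re z)² = |z|²/2 + Re(z²)/2, the sum splits into a part in |b_k X_k|² and a part in (b_k
  -- X_k)²; `A` and `B` are these two, centred. The mean removed from `B` is the pseudo-variance,
  -- controlled by `R`.
  set A : Ω → ℂ := fun s => ∑ k, ((‖b k‖ ^ 2 : ℝ) : ℂ) * ((‖X k s‖ ^ 2 : ℝ) : ℂ) -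
    ∑ k, ((‖b k‖ ^ 2 : ℝ) : ℂ) * v with hA
  set B : Ω → ℂ := fun s => ∑ k, b k ^ 2 * (X k s * X k s) -
    ∑ k, b k ^ 2 * ∑ j, U k j * U k j * ∫ t, Y j t * Y j t ∂P with hB
  have hAm : Measurable A := by fun_prop
  have hBm : Measurable B := by fun_prop
  have hA2 : ∫ s, ‖A s‖ ^ 2 ∂P ≤ 8 * C ^ 4 * ∑ k, ‖b k‖ ^ 4 := by
    refine (h.integral_norm_sq_sum_mul_norm_sq_sub_le hU fun k => ((‖b k‖ ^ 2 : ℝ) : ℂ)).trans_eq ?_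
    congr 1
    refine Finset.sum_congr rfl fun k _ => ?_
    rw [Complex.norm_real, Real.norm_of_nonneg (by positivity)]; ring
  have hB2 : ∫ s, ‖B s‖ ^ 2 ∂P ≤ 8 * C ^ 4 * ∑ k, ‖b k‖ ^ 4 := by
    refine (h.integral_norm_sq_quadratic_sub_le hU (fun k => b k ^ 2) (p := U) (f := id)
      (fun _ _ => rfl) measurable_id h.mean h.bound).trans_eq ?_
    congr 1
    refine Finset.sum_congr rfl fun k _ => ?_
    rw [norm_pow]; ring
  obtain ⟨KA, hKA⟩ : ∃ K, ∀ᵐ s ∂P, ‖A s‖ ≤ K := by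
    refine ⟨∑ k, ‖b k‖ ^ 2 * ((∑ j, ‖U k j‖) * C) ^ 2 + ‖∑ k, ((‖b k‖ ^ 2 : ℝ) : ℂ) * v‖, ?_⟩
    filter_upwards [hXb] with s hs
    refine (norm_sub_le _ _).trans (add_le_add_left ((norm_sum_le _ _).trans
      (Finset.sum_le_sum fun k _ => ?_)) _)
    rw [norm_mul, Complex.norm_real, Complex.norm_real, Real.norm_of_nonneg (by positivity),
      Real.norm_of_nonneg (by positivity)]
    gcongr
    exact hs k
  obtain ⟨KB, hKB⟩ : ∃ K, ∀ᵐ s ∂P, ‖B s‖ ≤ K := by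
    refine ⟨∑ k, ‖b k‖ ^ 2 * ((∑ j, ‖U k j‖) * C) ^ 2 +
      ‖∑ k, b k ^ 2 * ∑ j, U k j * U k j * ∫ t, Y j t * Y j t ∂P‖, ?_⟩
    filter_upwards [hXb] with s hs
    refine (norm_sub_le _ _).trans (add_le_add_left ((norm_sum_le _ _).trans
      (Finset.sum_le_sum fun k _ => ?_)) _)
    rw [norm_mul, norm_mul, norm_pow, ← sq]
    gcongr
    exact hs k
  have hAi : Integrable A P := Integrable.of_bound hAm.aestronglyMeasurable KA hKA
  have hBi : Integrable B P := Integrable.of_bound hBm.aestronglyMeasurable KB hKB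
  have hpt : ∀ s, |∑ k, (b k * X k s).re ^ 2 - v / 2 * ∑ k, ‖b k‖ ^ 2| ≤
      ‖A s‖ / 2 + ‖B s‖ / 2 + R / 2 := fun s => by
    have e1 : ∀ z : ℂ, z.re ^ 2 = ‖z‖ ^ 2 / 2 + (z * z).re / 2 := fun z => by
      rw [Complex.sq_norm, Complex.normSq_apply, Complex.mul_re]; ring
    have e2 : ∑ k, (b k * X k s).re ^ 2 - v / 2 * ∑ k, ‖b k‖ ^ 2 = ((A s).re +
        ((B s).re + (∑ k, b k ^ 2 * ∑ j, U k j * U k j * ∫ t, Y j t * Y j t ∂P).re)) / 2 := by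
      rw [hA, hB]
      simp only [Complex.sub_re, sub_add_cancel, Complex.re_sum]
      simp_rw [e1]
      rw [Finset.sum_add_distrib, ← Finset.sum_div, ← Finset.sum_div]
      have e3 : ∀ k, (((‖b k‖ ^ 2 : ℝ) : ℂ) * ((‖X k s‖ ^ 2 : ℝ) : ℂ)).re = ‖b k * X k s‖ ^ 2 :=
        fun k => by rw [← Complex.ofReal_mul, Complex.ofReal_re, norm_mul, mul_pow]
      have e4 : ∀ k, (((‖b k‖ ^ 2 : ℝ) : ℂ) * v).re = ‖b k‖ ^ 2 * v := fun k => by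
        rw [← Complex.ofReal_mul, Complex.ofReal_re]
      have e5 : ∀ k, b k ^ 2 * (X k s * X k s) = b k * X k s * (b k * X k s) := fun k => by ring
      simp_rw [e3, e4, e5]
      rw [← Finset.sum_mul]
      ring
    rw [e2, abs_div, abs_two]
    have h1 := Complex.abs_re_le_norm (A s)
    have h2 := Complex.abs_re_le_norm (B s)
    have h3 := (Complex.abs_re_le_norm
      (∑ k, b k ^ 2 * ∑ j, U k j * U k j * ∫ t, Y j t * Y j t ∂P)).trans hR
    have h4 := abs_add_le (A s).re
      ((B s).re + (∑ k, b k ^ 2 * ∑ j, U k j * U k j * ∫ t, Y j t * Y j t ∂P).re)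
    have h5 := abs_add_le (B s).re
      (∑ k, b k ^ 2 * ∑ j, U k j * U k j * ∫ t, Y j t * Y j t ∂P).re
    linarith
  have hi : Integrable (fun s => ‖A s‖ / 2 + ‖B s‖ / 2 + R / 2) P :=
    ((hAi.norm.div_const 2).add (hBi.norm.div_const 2)).add (integrable_const _)
  have hAB : Integrable (fun s => ‖A s‖ / 2 + ‖B s‖ / 2) P :=
    (hAi.norm.div_const 2).add (hBi.norm.div_const 2)
  calc _ ≤ ∫ s, (‖A s‖ / 2 + ‖B s‖ / 2 + R / 2) ∂P :=
        integral_mono_of_nonneg (ae_of_all _ fun s => abs_nonneg _) hi (ae_of_all _ hpt)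
    _ = (∫ s, ‖A s‖ ∂P) / 2 + (∫ s, ‖B s‖ ∂P) / 2 + R / 2 := by
        rw [integral_add hAB (integrable_const _),
          integral_add (hAi.norm.div_const 2) (hBi.norm.div_const 2), integral_div, integral_div]
        simp
    _ ≤ _ := by
        have h1 := integral_norm_le_sqrt hAm.aestronglyMeasurable hKA hA2
        have h2 := integral_norm_le_sqrt hBm.aestronglyMeasurable hKB hB2
        linarith

end IsErrorFamily

end ErrorFamily

/-! ### Cancellation of the pseudo-variance for DFT spreading -/

section Fourier

variable {m : ℕ}

theorem norm_dftMatrix_apply (k j : Fin m) : ‖dftMatrix m k j‖ = 1 / √m := by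
  have h : -(2 * (Real.pi : ℂ) * Complex.I * (k : ℕ) * (j : ℕ) / (m : ℂ)) =
      ((-(2 * Real.pi * (k : ℕ) * (j : ℕ) / m) : ℝ) : ℂ) * Complex.I := by push_cast; ring
  rw [dftMatrix, Matrix.of_apply, norm_div, h, Complex.norm_exp_ofReal_mul_I, Complex.norm_real,
    Real.norm_of_nonneg (Real.sqrt_nonneg _)]

/-- The number 2j lies in [0, 2m), an interval which contains two representatives of the class of c
modulo m. -/
theorem card_filter_dvd_sub_two_mul_le (c : ℤ) :
    (Finset.univ.filter fun j : Fin m => (m : ℤ) ∣ c - 2 * (j : ℕ)).card ≤ 2 := by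
  refine (Finset.card_le_card_of_injOn (t := {c % m, c % m + m})
    (fun j : Fin m => 2 * ((j : ℕ) : ℤ)) (fun j hj => ?_) (fun i _ j _ hij => ?_)).trans
    Finset.card_le_two
  · have hj' : (m : ℤ) ∣ c - 2 * (j : ℕ) := (Finset.mem_filter.1 hj).2
    have hm : (0 : ℤ) < m := by have := j.2; omega
    have h1 := Int.emod_nonneg c hm.ne'
    have h2 := Int.emod_lt_of_pos c hm
    have h3 := Int.emod_add_mul_ediv c m
    obtain ⟨t, ht⟩ := hj'
    have hjm : ((j : ℕ) : ℤ) < m := by exact_mod_cast j.2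
    have h4 : 2 * ((j : ℕ) : ℤ) = c % m + m * (c / m - t) := by rw [mul_sub, ← ht]; linarith
    have h5 : -1 < c / m - t := by
      by_contra hlt
      have : (m : ℤ) * (c / m - t) ≤ m * (-1) := mul_le_mul_of_nonneg_left (by omega) hm.le
      have : (0 : ℤ) ≤ (j : ℕ) := Int.natCast_nonneg _
      linarith
    have h6 : c / m - t < 2 := by
      by_contra hlt
      have : (m : ℤ) * 2 ≤ m * (c / m - t) := mul_le_mul_of_nonneg_left (by omega) hm.le
      linarith
    have h7 : c / m - t = 0 ∨ c / m - t = 1 := by omega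
    simp only [Finset.coe_insert, Finset.coe_singleton, Set.mem_insert_iff, Set.mem_singleton_iff]
    rcases h7 with h7 | h7
    · left; rw [h4, h7]; ring
    · right; rw [h4, h7]; ring
  · simp only at hij
    ext
    omega

/-- A geometric sum whose ratio is the m-th root of unity exp(2πi(a + b - 2j)/m). It vanishes unless
the ratio is one, and then there are m terms of modulus 1/m². -/
theorem norm_sum_dftMatrix_le (a b j : Fin m) :
    ‖∑ k, starRingEnd ℂ (dftMatrix m k a) * starRingEnd ℂ (dftMatrix m k b) *
      (dftMatrix m k j * dftMatrix m k j)‖ ≤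
      if (m : ℤ) ∣ ((a : ℕ) + (b : ℕ) : ℤ) - 2 * (j : ℕ) then 1 / (m : ℝ) else 0 := by
  have hm : 0 < m := a.pos
  have hmR : (0 : ℝ) < m := by exact_mod_cast hm
  have hmC : (m : ℂ) ≠ 0 := by exact_mod_cast hm.ne'
  split_ifs with h
  · refine (norm_sum_le _ _).trans ?_
    have : ∀ k : Fin m, ‖starRingEnd ℂ (dftMatrix m k a) * starRingEnd ℂ (dftMatrix m k b) *
        (dftMatrix m k j * dftMatrix m k j)‖ = 1 / (m : ℝ) * (1 / m) := fun k => by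
      simp only [norm_mul, RCLike.norm_conj, norm_dftMatrix_apply]
      have h1 : 1 / √(m : ℝ) * (1 / √m) = 1 / m := by
        rw [div_mul_div_comm, Real.mul_self_sqrt hmR.le, one_mul]
      rw [h1]
    simp_rw [this]
    rw [Finset.sum_const, Finset.card_univ, Fintype.card_fin, nsmul_eq_mul]
    field_simp
    rfl
  · set c : ℤ := ((a : ℕ) + (b : ℕ) : ℤ) - 2 * (j : ℕ) with hc
    set r : ℂ := Complex.exp (2 * Real.pi * Complex.I * c / m) with hr
    have hterm : ∀ k : Fin m, starRingEnd ℂ (dftMatrix m k a) * starRingEnd ℂ (dftMatrix m k b) *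
        (dftMatrix m k j * dftMatrix m k j) = r ^ (k : ℕ) / ((√m : ℝ) : ℂ) ^ 4 := fun k => by
      simp only [dftMatrix, Matrix.of_apply, map_div₀, ← Complex.exp_conj, Complex.conj_ofReal]
      rw [hr, ← Complex.exp_nat_mul]
      simp only [map_neg, map_div₀, map_mul, Complex.conj_I, Complex.conj_ofReal, map_ofNat,
        map_natCast]
      rw [div_mul_div_comm, div_mul_div_comm, div_mul_div_comm, ← Complex.exp_add,
        ← Complex.exp_add, ← Complex.exp_add]
      congr 1
      · congr 1
        rw [hc]
        push_cast
        field_simp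
        ring
      · ring
    simp_rw [hterm]
    rw [← Finset.sum_div, Fin.sum_univ_eq_sum_range (fun k => r ^ k)]
    have hrm : r ^ m = 1 := by
      rw [hr, ← Complex.exp_nat_mul, Complex.exp_eq_one_iff]
      refine ⟨c, ?_⟩
      field_simp
    have hr1 : r ≠ 1 := by
      intro h1
      rw [hr, Complex.exp_eq_one_iff] at h1
      obtain ⟨n, hn⟩ := h1
      have h2 : (2 : ℂ) * Real.pi * Complex.I ≠ 0 := Complex.two_pi_I_ne_zero
      have h3 : (c : ℂ) = m * n := by
        field_simp at hn
        exact hn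
      exact h ⟨n, by exact_mod_cast h3⟩
    rw [geom_sum_eq hr1, hrm, sub_self, zero_div, zero_div, norm_zero]

/-- For DFT spreading, the pseudo-variance of a linear functional of finitely many entries of the
noise term is of order `1 / m`. -/
theorem norm_sum_channelWeight_sq_dftMatrix_le {p : ℕ} (I : Fin p ↪ Fin m) (τ : Fin p → ℂ)
    (q : Fin m → ℂ) {K : ℝ} (hK : 0 ≤ K) (hq : ∀ j, ‖q j‖ ≤ K) :
    ‖∑ k, channelWeight (dftMatrix m) I τ k ^ 2 *
      ∑ j, dftMatrix m k j * dftMatrix m k j * q j‖ ≤ 2 * K * (∑ a, ‖τ a‖) ^ 2 / m := by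
  set S : Fin p → Fin p → Fin m → ℂ := fun a b j =>
    ∑ k, starRingEnd ℂ (dftMatrix m k (I a)) * starRingEnd ℂ (dftMatrix m k (I b)) *
      (dftMatrix m k j * dftMatrix m k j) with hS
  have hrew : ∑ k, channelWeight (dftMatrix m) I τ k ^ 2 *
      ∑ j, dftMatrix m k j * dftMatrix m k j * q j =
      ∑ a, ∑ b, τ a * τ b * ∑ j, S a b j * q j := by
    calc _ = ∑ k, ∑ a, ∑ b, ∑ j, τ a * τ b * (starRingEnd ℂ (dftMatrix m k (I a)) *
          starRingEnd ℂ (dftMatrix m k (I b)) * (dftMatrix m k j * dftMatrix m k j) * q j) := by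
          refine Finset.sum_congr rfl fun k _ => ?_
          rw [channelWeight, sq, Finset.sum_mul_sum, Finset.sum_mul]
          refine Finset.sum_congr rfl fun a _ => ?_
          rw [Finset.sum_mul]
          refine Finset.sum_congr rfl fun b _ => ?_
          rw [Finset.mul_sum]
          refine Finset.sum_congr rfl fun j _ => ?_
          ring
      _ = _ := by
          rw [Finset.sum_comm]
          refine Finset.sum_congr rfl fun a _ => ?_
          rw [Finset.sum_comm]
          refine Finset.sum_congr rfl fun b _ => ?_
          rw [Finset.sum_comm, Finset.mul_sum]
          refine Finset.sum_congr rfl fun j _ => ?_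
          rw [hS, Finset.sum_mul, Finset.mul_sum]
  -- At most two indices j survive the cancellation, each contributing at most K/m.
  have hSb : ∀ a b, ‖∑ j, S a b j * q j‖ ≤ 2 * K / m := fun a b => by
    calc ‖∑ j, S a b j * q j‖ ≤ ∑ j : Fin m,
          (if (m : ℤ) ∣ ((I a : ℕ) + (I b : ℕ) : ℤ) - 2 * (j : ℕ) then 1 / (m : ℝ) else 0) * K := by
          refine (norm_sum_le _ _).trans (Finset.sum_le_sum fun j _ => ?_)
          rw [norm_mul]
          have h1 := norm_sum_dftMatrix_le (I a) (I b) j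
          exact mul_le_mul h1 (hq j) (norm_nonneg _) ((norm_nonneg _).trans h1)
      _ = (Finset.univ.filter fun j : Fin m =>
            (m : ℤ) ∣ ((I a : ℕ) + (I b : ℕ) : ℤ) - 2 * (j : ℕ)).card * (K / m) := by
          rw [← Finset.sum_mul, ← Finset.sum_filter, Finset.sum_const, nsmul_eq_mul]
          ring
      _ ≤ 2 * (K / m) := by
          refine mul_le_mul_of_nonneg_right ?_ (by positivity)
          exact Nat.cast_le.2 (card_filter_dvd_sub_two_mul_le _)
      _ = _ := by ring
  rw [hrew]
  calc ‖∑ a, ∑ b, τ a * τ b * ∑ j, S a b j * q j‖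
      ≤ ∑ a, ∑ b, ‖τ a‖ * ‖τ b‖ * (2 * K / m) := by
        refine (norm_sum_le _ _).trans (Finset.sum_le_sum fun a _ => (norm_sum_le _ _).trans
          (Finset.sum_le_sum fun b _ => ?_))
        rw [norm_mul, norm_mul]
        gcongr
        exact hSb a b
    _ = _ := by
        rw [sq, Finset.sum_mul_sum, Finset.mul_sum, Finset.sum_div]
        refine Finset.sum_congr rfl fun a _ => ?_
        rw [Finset.mul_sum, Finset.sum_div]
        refine Finset.sum_congr rfl fun b _ => ?_
        ring

end Fourier

/-! ### Characteristic function of the noise for fixed spreading -/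

section FixedSpreading

variable {m : ℕ}

/-- The noise term for unitary spreading `U`, error signal `e` and pairs `g` of channel
coefficients and additive noise. -/
noncomputable def noiseSum (U : Matrix (Fin m) (Fin m) ℂ) (e : Fin m → ℂ) (g : Fin m → ℂ × ℂ)
    (i : Fin m) : ℂ :=
  ∑ k, channelTerm (starRingEnd ℂ (U k i) * ∑ j, U k j * e j) (starRingEnd ℂ (U k i)) (g k)

/-- Writing the subtracted e as U*Ue turns the coefficient |h_k|² of (Ue)_k into the centred |h_k|²
- 1. -/
theorem noiseTerm_eq_noiseSum {U : Matrix (Fin m) (Fin m) ℂ}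
    (hU : U ∈ Matrix.unitaryGroup (Fin m) ℂ) (h x xhat w : Fin m → ℂ) (i : Fin m) :
    noiseTerm h U x xhat w i = noiseSum U (x - xhat) (fun k => (h k, w k)) i := by
  have hres : residualVector (systemMatrix h U) (received (systemMatrix h U) x w) xhat =
      Matrix.diagonal h *ᵥ (U *ᵥ (x - xhat)) + w := by
    rw [residualVector, received, systemMatrix, ← Matrix.mulVec_mulVec, ← Matrix.mulVec_mulVec,
      Matrix.mulVec_sub, Matrix.mulVec_sub]
    abel
  have hconj : ∀ y : Fin m → ℂ, (Uᴴ *ᵥ y) i = ∑ k, starRingEnd ℂ (U k i) * y k := fun _ => rfl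
  have hone : (x - xhat) i = ∑ k, starRingEnd ℂ (U k i) * (U *ᵥ (x - xhat)) k := by
    rw [← hconj, Matrix.mulVec_mulVec, ← Matrix.star_eq_conjTranspose,
      Matrix.mem_unitaryGroup_iff'.1 hU, Matrix.one_mulVec]
  rw [noiseTerm, Pi.sub_apply, errorEstimate, hres, hone, noiseSum, systemMatrix,
    Matrix.conjTranspose_mul, Matrix.diagonal_conjTranspose, ← Matrix.mulVec_mulVec, hconj,
    ← Finset.sum_sub_distrib]
  refine Finset.sum_congr rfl fun k _ => ?_
  have h4 : ((‖h k‖ ^ 2 - 1 : ℝ) : ℂ) = starRingEnd ℂ (h k) * h k - 1 := by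
    rw [Complex.conj_mul']; push_cast; ring
  have h5 : ∑ j, U k j * (x - xhat) j = (U *ᵥ (x - xhat)) k := rfl
  rw [channelTerm, h4, h5, Matrix.mulVec_diagonal, Pi.add_apply, Matrix.mulVec_diagonal,
    Pi.star_apply, ← starRingEnd_apply]
  ring

/-- `channelTerm` is linear in its pair of coefficients, and for fixed k all entries share the
factor (Ue)_k. -/
theorem sum_mul_noiseSum (U : Matrix (Fin m) (Fin m) ℂ) (e : Fin m → ℂ) (g : Fin m → ℂ × ℂ)
    {p : ℕ} (I : Fin p ↪ Fin m) (τ : Fin p → ℂ) :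
    ∑ a, τ a * noiseSum U e g (I a) = ∑ k, channelTerm
      (channelWeight U I τ k * ∑ j, U k j * e j) (channelWeight U I τ k) (g k) := by
  have h : ∀ a, τ a * noiseSum U e g (I a) = ∑ k, τ a * channelTerm
      (starRingEnd ℂ (U k (I a)) * ∑ j, U k j * e j) (starRingEnd ℂ (U k (I a))) (g k) :=
    fun a => by rw [noiseSum, Finset.mul_sum]
  simp_rw [h]
  rw [Finset.sum_comm]
  refine Finset.sum_congr rfl fun k _ => ?_
  generalize ∑ j, U k j * e j = X
  rw [channelTerm, channelWeight, mul_assoc, Finset.sum_mul, Finset.sum_mul,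
    ← Finset.sum_add_distrib]
  refine Finset.sum_congr rfl fun a _ => ?_
  rw [channelTerm]
  ring

theorem integral_cexp_sum_channelTerm (σ : ℝ) (a c : Fin m → ℂ) :
    ∫ g, Complex.exp ((∑ k, channelTerm (a k) (c k) (g k)).re * Complex.I)
      ∂(Measure.pi fun _ : Fin m => channelNoise σ) =
      ∏ k, Complex.exp (-((a k).re * Complex.I)) /
        (1 + ((σ ^ 2 * ‖c k‖ ^ 2 / 4 : ℝ) - (a k).re * Complex.I)) := by
  simp_rw [← integral_cexp_channelTerm]
  rw [← integral_fintype_prod_eq_prod]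
  congr 1
  ext g
  rw [← Complex.exp_sum, Complex.re_sum, Complex.ofReal_sum, Finset.sum_mul]

theorem norm_cexp_neg_sub_cexp_neg_le {r s : ℝ} (hr : 0 ≤ r) (hs : 0 ≤ s) :
    ‖Complex.exp (-(r : ℂ)) - Complex.exp (-(s : ℂ))‖ ≤ |r - s| := by
  rw [← Complex.ofReal_neg, ← Complex.ofReal_neg, ← Complex.ofReal_exp, ← Complex.ofReal_exp,
    ← Complex.ofReal_sub, Complex.norm_real, Real.norm_eq_abs]
  wlog h : r ≤ s generalizing r s
  · rw [abs_sub_comm, abs_sub_comm r s]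
    exact this hs hr (le_of_not_ge h)
  have h1 : Real.exp (-s) ≤ Real.exp (-r) := Real.exp_le_exp.2 (by linarith)
  rw [abs_of_nonneg (by linarith), abs_of_nonpos (by linarith)]
  have h2 : Real.exp (-s) = Real.exp (-r) * Real.exp (r - s) := by
    rw [← Real.exp_add]; ring_nf
  have h3 := Real.add_one_le_exp (r - s)
  have h4 : Real.exp (-r) ≤ 1 := Real.exp_le_one_iff.2 (by linarith)
  have h5 := Real.exp_pos (-r)
  nlinarith

/-- The constant in the bound for the characteristic function of the noise term. -/
noncomputable def charBound (C σ : ℝ) {p : ℕ} (τ : Fin p → ℂ) : ℝ :=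
  (8 + 8 * (σ ^ 2 / 4) ^ 3 * (∑ a, ‖τ a‖) ^ 3 + (σ ^ 2 / 4) ^ 2 * (∑ a, ‖τ a‖) + σ ^ 2 / 4) *
    (1 + 18 * C ^ 4) * (∑ a, ‖τ a‖) * (∑ a, ‖τ a‖ ^ 2) +
  √(8 * C ^ 4 * ∑ a, ‖τ a‖ ^ 2) * (∑ a, ‖τ a‖)

/-- There are three errors. The cubic expansion costs Σ|b_k|³ and the fluctuation of the conditional
variance costs (Σ|b_k|⁴)^(1/2); both are O(δ), since |b_k| ≤ Tδ and Σ|b_k|² is fixed. The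
pseudo-variance costs O(1/m). -/
theorem norm_integral_cexp_noiseSum_sub_le [NeZero m] {μ : Measure (Fin m → ℂ)}
    [IsProbabilityMeasure μ] {C v σ : ℝ} (hμ : IsErrorFamily μ (fun j e => e j) C v)
    {U : Matrix (Fin m) (Fin m) ℂ} (hU : U ∈ Matrix.unitaryGroup (Fin m) ℂ)
    (hproper : (∀ j, ∫ e, e j ^ 2 ∂μ = 0) ∨ U = dftMatrix m) {δ : ℝ} (hδ : ∀ k j, ‖U k j‖ ≤ δ)
    {p : ℕ} (I : Fin p ↪ Fin m) (τ : Fin p → ℂ) :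
    ‖∫ e, ∫ g, Complex.exp ((∑ a, τ a * noiseSum U e g (I a)).re * Complex.I)
        ∂(Measure.pi fun _ : Fin m => channelNoise σ) ∂μ -
      Complex.exp (-(((v + σ ^ 2) / 4 * ∑ a, ‖τ a‖ ^ 2 : ℝ) : ℂ))‖ ≤
      charBound C σ τ * δ + C ^ 2 * (∑ a, ‖τ a‖) ^ 2 / m := by
  set b := channelWeight U I τ with hb
  set T := ∑ a, ‖τ a‖ with hT
  set S := ∑ a, ‖τ a‖ ^ 2 with hS
  set κ := σ ^ 2 / 4 with hκ
  set X : Fin m → (Fin m → ℂ) → ℂ := fun k e => ∑ j, U k j * e j with hX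
  set K := 8 + 8 * κ ^ 3 * T ^ 3 + κ ^ 2 * T + κ with hK
  have hT0 : 0 ≤ T := Finset.sum_nonneg fun _ _ => norm_nonneg _
  have hS0 : 0 ≤ S := Finset.sum_nonneg fun _ _ => by positivity
  have hκ0 : 0 ≤ κ := by positivity
  have hK0 : 0 ≤ K := by positivity
  have hδ0 : 0 ≤ δ := (norm_nonneg _).trans (hδ 0 0)
  have hv : 0 ≤ v := hμ.var_nonneg
  have hbS : ∑ k, ‖b k‖ ^ 2 = S := sum_norm_sq_channelWeight hU I τ
  -- This bound without δ serves only to keep the constant `K` independent of δ.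
  have hbT : ∀ k, ‖b k‖ ≤ T := fun k => by
    simpa using norm_channelWeight_le I τ (norm_entry_le_one hU) k
  have hbδ : ∀ k, ‖b k‖ ≤ T * δ := norm_channelWeight_le I τ hδ
  have hXm : ∀ k, Measurable (X k) := fun k => hμ.measurable_sum (U k)
  set φ : (Fin m → ℂ) → ℂ := fun e => ∏ k, Complex.exp (-((b k * X k e).re * Complex.I)) /
        (1 + ((κ * ‖b k‖ ^ 2 : ℝ) - (b k * X k e).re * Complex.I)) with hφ
  have hin : ∀ e, ∫ g, Complex.exp ((∑ a, τ a * noiseSum U e g (I a)).re * Complex.I)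
      ∂(Measure.pi fun _ : Fin m => channelNoise σ) = φ e := fun e => by
    simp_rw [sum_mul_noiseSum]
    rw [integral_cexp_sum_channelTerm]
    refine Finset.prod_congr rfl fun k _ => ?_
    rw [hκ, show σ ^ 2 * ‖b k‖ ^ 2 / 4 = σ ^ 2 / 4 * ‖b k‖ ^ 2 by ring]
  have hφ1 : ∀ e, ‖φ e‖ ≤ 1 := fun e => by
    rw [hφ, norm_prod]
    exact Finset.prod_le_one (fun _ _ => norm_nonneg _) fun k _ =>
      norm_cexp_div_le_one (by positivity) _
  have hφm : Measurable φ := Finset.measurable_prod _ fun k _ => by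
    have := hXm k
    fun_prop
  have hφi : Integrable φ μ := Integrable.of_bound hφm.aestronglyMeasurable 1 (ae_of_all _ hφ1)
  set R := 2 * C ^ 2 * T ^ 2 / m with hR
  have hpseudo : ‖∑ k, b k ^ 2 * ∑ j, U k j * U k j * ∫ e, e j * e j ∂μ‖ ≤ R := by
    rcases hproper with h | h
    · have h' : ∀ j, ∫ e, e j * e j ∂μ = 0 := fun j => by simpa [sq] using h j
      simp only [h', mul_zero, Finset.sum_const_zero, norm_zero]
      positivity
    · subst h
      exact norm_sum_channelWeight_sq_dftMatrix_le I τ _ (by positivity) hμ.norm_integral_sq_le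
  have hV := hμ.integral_abs_sum_sq_sub_le hU b hpseudo
  rw [hbS] at hV
  set W : (Fin m → ℂ) → ℝ := fun e =>
    |∑ k, (b k * ∑ j, U k j * e j).re ^ 2 - v / 2 * S| with hW
  have hpt : ∀ e, ‖φ e - Complex.exp (-(((v + σ ^ 2) / 4 * S : ℝ) : ℂ))‖ ≤
      ∑ k, K * ‖b k‖ ^ 3 * (1 + ‖X k e‖ ^ 4) + W e / 2 := fun e => by
    have h1 : ‖φ e - ∏ k, Complex.exp (-((κ * ‖b k‖ ^ 2 + (b k * X k e).re ^ 2 / 2 : ℝ) : ℂ))‖ ≤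
        ∑ k, K * ‖b k‖ ^ 3 * (1 + ‖X k e‖ ^ 4) := by
      refine (norm_prod_sub_prod_le _ _ _ (fun k => norm_cexp_div_le_one (by positivity) _)
        fun k => norm_cexp_neg_le_one (by positivity)).trans (Finset.sum_le_sum fun k _ => ?_)
      refine norm_cexp_div_sub_cexp_le_cube hκ0 (norm_nonneg _) (hbT k) ?_
      rw [← norm_mul]
      exact Complex.abs_re_le_norm _
    have h2 : ∏ k, Complex.exp (-((κ * ‖b k‖ ^ 2 + (b k * X k e).re ^ 2 / 2 : ℝ) : ℂ)) =
        Complex.exp (-((κ * S + (∑ k, (b k * X k e).re ^ 2) / 2 : ℝ) : ℂ)) := by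
      rw [← Complex.exp_sum, Finset.sum_neg_distrib, ← Complex.ofReal_sum,
        Finset.sum_add_distrib, ← Finset.mul_sum, hbS, Finset.sum_div]
    rw [h2] at h1
    have h3 := norm_cexp_neg_sub_cexp_neg_le
      (r := κ * S + (∑ k, (b k * X k e).re ^ 2) / 2) (s := (v + σ ^ 2) / 4 * S)
      (by positivity) (by positivity)
    have h4 : κ * S + (∑ k, (b k * X k e).re ^ 2) / 2 - (v + σ ^ 2) / 4 * S =
        (∑ k, (b k * X k e).re ^ 2 - v / 2 * S) / 2 := by rw [hκ]; ring
    rw [h4, abs_div, abs_two] at h3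
    exact (norm_sub_le_norm_sub_add_norm_sub _ _ _).trans (add_le_add h1 h3)
  have hX4 : ∀ k, Integrable (fun e => ‖X k e‖ ^ 4) μ := fun k =>
    hμ.integrable_norm_pow_sum (U k) 4
  have hi1 : ∀ k, Integrable (fun e => K * ‖b k‖ ^ 3 * (1 + ‖X k e‖ ^ 4)) μ := fun k =>
    ((integrable_const _).add (hX4 k)).const_mul _
  have hi2 : Integrable W μ := by
    have hre : ∀ k, Integrable (fun e => (b k * X k e).re ^ 2) μ := fun k => by
      have h2 := (hμ.integrable_norm_pow_sum (U k) 2).const_mul (‖b k‖ ^ 2)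
      refine h2.mono' ?_ (ae_of_all _ fun e => ?_)
      · have := hXm k
        exact Measurable.aestronglyMeasurable (by fun_prop)
      · rw [Real.norm_of_nonneg (by positivity), ← mul_pow, ← norm_mul, ← sq_abs]
        gcongr
        exact Complex.abs_re_le_norm _
    exact ((integrable_finsetSum _ fun k _ => hre k).sub (integrable_const _)).abs
  have hsum : ∑ k, K * ‖b k‖ ^ 3 * (1 + ∫ e, ‖X k e‖ ^ 4 ∂μ) ≤
      K * (1 + 18 * C ^ 4) * T * S * δ := by
    calc _ ≤ ∑ k, K * (T * δ * ‖b k‖ ^ 2) * (1 + 18 * C ^ 4) := by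
          refine Finset.sum_le_sum fun k _ => ?_
          have h4 := hμ.integral_norm_pow_four_le hU k
          have h3 : ‖b k‖ ^ 3 ≤ T * δ * ‖b k‖ ^ 2 := by
            rw [pow_succ']
            exact mul_le_mul_of_nonneg_right (hbδ k) (by positivity)
          have h0 : 0 ≤ ∫ e, ‖X k e‖ ^ 4 ∂μ := integral_nonneg fun e => by positivity
          gcongr
      _ = _ := by
          rw [← Finset.sum_mul, ← Finset.mul_sum, ← Finset.mul_sum, hbS]; ring
  have hsqrt : √(8 * C ^ 4 * ∑ k, ‖b k‖ ^ 4) ≤ √(8 * C ^ 4 * S) * T * δ := by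
    have h4 : ∑ k, ‖b k‖ ^ 4 ≤ S * (T * δ) ^ 2 := by
      rw [← hbS, Finset.sum_mul]
      refine Finset.sum_le_sum fun k _ => ?_
      calc ‖b k‖ ^ 4 = ‖b k‖ ^ 2 * ‖b k‖ ^ 2 := by ring
        _ ≤ _ := by gcongr; exact hbδ k
    calc √(8 * C ^ 4 * ∑ k, ‖b k‖ ^ 4) ≤ √(8 * C ^ 4 * (S * (T * δ) ^ 2)) := by gcongr
      _ = √(8 * C ^ 4 * S * (T * δ) ^ 2) := by rw [mul_assoc (8 * C ^ 4)]
      _ = √(8 * C ^ 4 * S) * (T * δ) := by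
          rw [Real.sqrt_mul (by positivity), Real.sqrt_sq (by positivity)]
      _ = _ := by ring
  have hsub : ∫ e, φ e ∂μ - Complex.exp (-(((v + σ ^ 2) / 4 * S : ℝ) : ℂ)) =
      ∫ e, (φ e - Complex.exp (-(((v + σ ^ 2) / 4 * S : ℝ) : ℂ))) ∂μ := by
    rw [integral_sub hφi (integrable_const _)]
    simp
  simp_rw [hin]
  rw [hsub]
  have hi3 : Integrable (fun e => ∑ k, K * ‖b k‖ ^ 3 * (1 + ‖X k e‖ ^ 4)) μ :=
    integrable_finsetSum _ fun k _ => hi1 k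
  calc _ ≤ ∫ e, (∑ k, K * ‖b k‖ ^ 3 * (1 + ‖X k e‖ ^ 4) + W e / 2) ∂μ :=
        norm_integral_le_of_norm_le (hi3.add (hi2.div_const 2)) (ae_of_all _ hpt)
    _ = ∑ k, K * ‖b k‖ ^ 3 * (1 + ∫ e, ‖X k e‖ ^ 4 ∂μ) + (∫ e, W e ∂μ) / 2 := by
        rw [integral_add hi3 (hi2.div_const 2), integral_div, integral_finsetSum _ fun k _ => hi1 k]
        congr 1
        refine Finset.sum_congr rfl fun k _ => ?_
        rw [integral_const_mul, integral_add (integrable_const _) (hX4 k)]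
        simp
    _ ≤ _ := by
        have h0 := Real.sqrt_nonneg (8 * C ^ 4 * ∑ k, ‖b k‖ ^ 4)
        have hR2 : R / 2 = C ^ 2 * T ^ 2 / m := by rw [hR]; ring
        have hR0 : 0 ≤ C ^ 2 * T ^ 2 / m := by positivity
        have : charBound C σ τ * δ =
            K * (1 + 18 * C ^ 4) * T * S * δ + √(8 * C ^ 4 * S) * T * δ := by
          rw [charBound]; ring
        rw [this]
        linarith

end FixedSpreading

/-! ### Exact moments for fixed spreading -/

section SecondMoment

variable {m : ℕ}

theorem integral_norm_sq_sum_pi {α : Type*} [MeasurableSpace α] {μ : Measure α}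
    [IsProbabilityMeasure μ] {f : Fin m → α → ℂ} (hf : ∀ k, MemLp (f k) 2 μ)
    (h0 : ∀ k, ∫ a, f k a ∂μ = 0) :
    ∫ g, ‖∑ k, f k (g k)‖ ^ 2 ∂(Measure.pi fun _ : Fin m => μ) =
      ∑ k, ∫ a, ‖f k a‖ ^ 2 ∂μ := by
  have hmp : ∀ k, MeasurePreserving (Function.eval k) (Measure.pi fun _ : Fin m => μ) μ := fun k =>
    measurePreserving_eval (fun _ : Fin m => μ) k
  have hL : ∀ k, MemLp (fun g : Fin m → α => f k (g k)) 2 (Measure.pi fun _ : Fin m => μ) :=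
    fun k => (hf k).comp_measurePreserving (hmp k)
  have hconj : ∀ k, MemLp (fun g : Fin m → α => starRingEnd ℂ (f k (g k))) 2
      (Measure.pi fun _ : Fin m => μ) := fun k => (hL k).star
  have hint : ∀ k l, Integrable (fun g : Fin m → α => f k (g k) * starRingEnd ℂ (f l (g l)))
      (Measure.pi fun _ : Fin m => μ) := fun k l => MemLp.integrable_mul (hL k) (hconj l)
  have hind : iIndepFun (fun k (g : Fin m → α) => f k (g k)) (Measure.pi fun _ : Fin m => μ) :=
    iIndepFun_pi fun k => (hf k).1.aemeasurable
  have hval : ∀ k l, ∫ g, f k (g k) * starRingEnd ℂ (f l (g l)) ∂(Measure.pi fun _ : Fin m => μ) =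
      if k = l then ((∫ a, ‖f k a‖ ^ 2 ∂μ : ℝ) : ℂ) else 0 := by
    intro k l
    split_ifs with hkl
    · subst hkl
      simp_rw [Complex.mul_conj', ← Complex.ofReal_pow]
      rw [integral_complex_ofReal]
      congr 1
      exact integral_comp_eval (μ := fun _ : Fin m => μ) (i := k) (f := fun a => ‖f k a‖ ^ 2)
        ((hf k).1.norm.pow 2)
    · have h1 := (hind.indepFun hkl).comp measurable_id Complex.continuous_conj.measurable
      have h2 := h1.integral_fun_mul_eq_mul_integral (hL k).1 (hconj l).1
      simp only [Function.comp_apply, id] at h2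
      rw [h2]
      have h3 : ∫ g, f k (g k) ∂(Measure.pi fun _ : Fin m => μ) = 0 := by
        rw [← h0 k]
        exact integral_comp_eval (μ := fun _ : Fin m => μ) (i := k) (f := f k) (hf k).1
      exact mul_eq_zero_of_left h3 _
  have key : ((∫ g, ‖∑ k, f k (g k)‖ ^ 2 ∂(Measure.pi fun _ : Fin m => μ) : ℝ) : ℂ) =
      ((∑ k, ∫ a, ‖f k a‖ ^ 2 ∂μ : ℝ) : ℂ) := by
    rw [← integral_complex_ofReal]
    simp_rw [ofReal_norm_sq_sum]
    rw [integral_finsetSum _ fun p _ => integrable_finsetSum _ fun r _ => hint p r,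
      Complex.ofReal_sum]
    refine Finset.sum_congr rfl fun k _ => ?_
    rw [integral_finsetSum _ fun r _ => hint k r]
    simp_rw [hval]
    simp
  exact_mod_cast key

variable {U : Matrix (Fin m) (Fin m) ℂ}

theorem integral_noiseSum (σ : ℝ) (e : Fin m → ℂ) (i : Fin m) :
    ∫ g, noiseSum U e g i ∂(Measure.pi fun _ : Fin m => channelNoise σ) = 0 := by
  have hL : ∀ (k : Fin m) a c, Integrable (fun g : Fin m → ℂ × ℂ => channelTerm a c (g k))
      (Measure.pi fun _ : Fin m => channelNoise σ) := fun k a c =>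
    ((memLp_channelTerm σ a c).comp_measurePreserving
      (measurePreserving_eval (fun _ : Fin m => channelNoise σ) k)).integrable one_le_two
  simp only [noiseSum]
  rw [integral_finsetSum _ fun k _ => hL k _ _]
  refine Finset.sum_eq_zero fun k _ => ?_
  rw [integral_comp_eval (μ := fun _ : Fin m => channelNoise σ) (i := k)
    (memLp_channelTerm σ _ _).1, integral_channelTerm]

theorem integral_norm_sq_noiseSum (σ : ℝ) (e : Fin m → ℂ) (i : Fin m) :
    ∫ g, ‖noiseSum U e g i‖ ^ 2 ∂(Measure.pi fun _ : Fin m => channelNoise σ) =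
      ∑ k, ‖U k i‖ ^ 2 * (‖∑ j, U k j * e j‖ ^ 2 + σ ^ 2) := by
  simp only [noiseSum]
  rw [integral_norm_sq_sum_pi (fun k => memLp_channelTerm σ _ _)
    fun k => integral_channelTerm σ _ _]
  refine Finset.sum_congr rfl fun k _ => ?_
  rw [integral_norm_sq_channelTerm, norm_mul, RCLike.norm_conj]
  ring

/-- Unit rows of U give E|X_k|² = v for every k, and the unit column i then averages v + σ² with
total weight one. -/
theorem integral_integral_norm_sq_noiseSum {μ : Measure (Fin m → ℂ)} [IsProbabilityMeasure μ]
    {C v : ℝ} (hμ : IsErrorFamily μ (fun j e => e j) C v)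
    (hU : U ∈ Matrix.unitaryGroup (Fin m) ℂ) (σ : ℝ) (i : Fin m) :
    ∫ e, ∫ g, ‖noiseSum U e g i‖ ^ 2 ∂(Measure.pi fun _ : Fin m => channelNoise σ) ∂μ =
      v + σ ^ 2 := by
  simp_rw [integral_norm_sq_noiseSum]
  have hi : ∀ k, Integrable (fun e : Fin m → ℂ => ‖∑ j, U k j * e j‖ ^ 2) μ := fun k =>
    hμ.integrable_norm_pow_sum (U k) 2
  have hv : ∀ k, ∫ e, ‖∑ j, U k j * e j‖ ^ 2 ∂μ = v := fun k => by
    have := hμ.integral_norm_sq_sum (U k)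
    rwa [sum_norm_sq_row hU, one_mul] at this
  have hi' : ∀ k, Integrable (fun e : Fin m → ℂ =>
      ‖U k i‖ ^ 2 * (‖∑ j, U k j * e j‖ ^ 2 + σ ^ 2)) μ := fun k =>
    ((hi k).add (integrable_const _)).const_mul _
  rw [integral_finsetSum _ fun k _ => hi' k]
  have h1 : ∀ k, ∫ e, ‖U k i‖ ^ 2 * (‖∑ j, U k j * e j‖ ^ 2 + σ ^ 2) ∂μ =
      ‖U k i‖ ^ 2 * (v + σ ^ 2) := fun k => by
    rw [integral_const_mul, integral_add (hi k) (integrable_const _), hv]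
    simp
  simp_rw [h1]
  rw [← Finset.sum_mul, sum_norm_sq_col hU, one_mul]

end SecondMoment

/-! ### Averaging over random spreading -/

section Receiver

variable {Ω : Type*} [MeasurableSpace Ω] {m : ℕ}

theorem IsErrorFamily.map_law {P : Measure Ω} [IsProbabilityMeasure P] {e : Ω → Fin m → ℂ}
    {C v : ℝ} (he : Measurable e) (h : IsErrorFamily P (fun j s => e s j) C v) :
    IsErrorFamily (P.map e) (fun j y => y j) C v where
  indep := by
    have hp : IsProbabilityMeasure (P.map e) := Measure.isProbabilityMeasure_map he.aemeasurable
    rw [iIndepFun_iff_map_fun_eq_pi_map fun j => (measurable_pi_apply j).aemeasurable]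
    have h1 := (iIndepFun_iff_map_fun_eq_pi_map fun j => (h.meas j).aemeasurable).1 h.indep
    have h2 : ∀ j, (P.map e).map (fun y => y j) = P.map fun s => e s j := fun j =>
      Measure.map_map (measurable_pi_apply j) he
    simp only [h2]
    exact Measure.map_id'.trans h1
  meas j := measurable_pi_apply j
  bound := by
    rw [ae_map_iff he.aemeasurable]
    · exact h.bound
    · have h1 : {y : Fin m → ℂ | ∀ j, ‖y j‖ ≤ C} = ⋂ j, {y | ‖y j‖ ≤ C} := by
        ext y; simp
      rw [h1]
      exact MeasurableSet.iInter fun j =>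
        measurableSet_le (measurable_pi_apply j).norm measurable_const
  mean j := by
    rw [integral_map he.aemeasurable (measurable_pi_apply j).aestronglyMeasurable]
    exact h.mean j
  var j := by
    rw [integral_map he.aemeasurable
      ((measurable_pi_apply j).norm.pow_const 2).aestronglyMeasurable]
    exact h.var j

/-- The probabilistic assumptions on the receiver for one block length, with error signal `e`. -/
structure IsReceiverModel (P : Measure Ω) (σ C v : ℝ) (U : Ω → Matrix (Fin m) (Fin m) ℂ)
    (e h w : Ω → Fin m → ℂ) : Prop where
  law_channel : HasLaw h (Measure.pi fun _ : Fin m => complexGaussian 1) P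
  law_noise : HasLaw w (Measure.pi fun _ : Fin m => complexGaussian (σ ^ 2)) P
  meas_spreading : ∀ k j, Measurable fun s => U s k j
  unitary : ∀ᵐ s ∂P, U s ∈ Matrix.unitaryGroup (Fin m) ℂ
  meas_error : Measurable e
  error : IsErrorFamily P (fun j s => e s j) C v
  indep_spreading : IndepFun (fun s (k j : Fin m) => U s k j) (fun s => (e s, h s, w s)) P
  indep_error : IndepFun e (fun s => (h s, w s)) P
  indep_noise : IndepFun h w P

namespace IsReceiverModel

variable {P : Measure Ω} {σ C v : ℝ}
  {U : Ω → Matrix (Fin m) (Fin m) ℂ} {e h w : Ω → Fin m → ℂ}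

/-- The law of the entries of the spreading matrix. -/
noncomputable def spreadingLaw (P : Measure Ω) (U : Ω → Matrix (Fin m) (Fin m) ℂ) :
    Measure (Fin m → Fin m → ℂ) :=
  P.map fun s k j => U s k j

theorem measurable_spreading (H : IsReceiverModel P σ C v U e h w) :
    Measurable fun s (k j : Fin m) => U s k j :=
  measurable_pi_lambda _ fun k => measurable_pi_lambda _ fun j => H.meas_spreading k j

theorem continuous_noiseSum (i : Fin m) :
    Continuous fun y : (Fin m → Fin m → ℂ) × (Fin m → ℂ) × (Fin m → ℂ × ℂ) =>
      noiseSum (Matrix.of y.1) y.2.1 y.2.2 i := by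
  simp only [noiseSum, channelTerm, Matrix.of_apply]
  fun_prop

theorem measurable_zip : Measurable fun (y : (Fin m → ℂ) × (Fin m → ℂ)) k => (y.1 k, y.2 k) :=
  measurable_pi_lambda _ fun k => by fun_prop

theorem measurableSet_unitary :
    MeasurableSet {u : Fin m → Fin m → ℂ | Matrix.of u ∈ Matrix.unitaryGroup (Fin m) ℂ} := by
  have h : {u : Fin m → Fin m → ℂ | Matrix.of u ∈ Matrix.unitaryGroup (Fin m) ℂ} =
      ⋂ k, ⋂ k', {u | ∑ j, u k j * starRingEnd ℂ (u k' j) = if k = k' then 1 else 0} := by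
    ext u
    simp only [Set.mem_ofPred_eq, Set.mem_iInter]
    refine ⟨fun hu => sum_row_mul_conj_row hu, fun hu => ?_⟩
    rw [Matrix.mem_unitaryGroup_iff]
    ext k k'
    rw [Matrix.mul_apply, Matrix.one_apply, ← hu k k']
    rfl
  rw [h]
  refine MeasurableSet.iInter fun k => MeasurableSet.iInter fun k' => ?_
  refine (isClosed_eq ?_ continuous_const).measurableSet
  fun_prop

theorem ae_unitary (H : IsReceiverModel P σ C v U e h w) :
    ∀ᵐ u ∂(spreadingLaw P U), Matrix.of u ∈ Matrix.unitaryGroup (Fin m) ℂ := by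
  rw [spreadingLaw, ae_map_iff H.measurable_spreading.aemeasurable measurableSet_unitary]
  exact H.unitary

variable [IsProbabilityMeasure P]

theorem isProbabilityMeasure_spreadingLaw (H : IsReceiverModel P σ C v U e h w) :
    IsProbabilityMeasure (spreadingLaw P U) :=
  Measure.isProbabilityMeasure_map H.measurable_spreading.aemeasurable

theorem hasLaw_channel_noise (H : IsReceiverModel P σ C v U e h w) :
    HasLaw (fun s k => (h s k, w s k)) (Measure.pi fun _ : Fin m => channelNoise σ) P := by
  have h1 : HasLaw (fun s => (h s, w s)) ((Measure.pi fun _ : Fin m => complexGaussian 1).prod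
      (Measure.pi fun _ : Fin m => complexGaussian (σ ^ 2))) P :=
    ⟨H.law_channel.aemeasurable.prodMk H.law_noise.aemeasurable, by
      rw [(indepFun_iff_map_prod_eq_prod_map_map H.law_channel.aemeasurable
        H.law_noise.aemeasurable).1 H.indep_noise, H.law_channel.map_eq, H.law_noise.map_eq]⟩
  have h2 := (measurePreserving_arrowProdEquivProdArrow ℂ ℂ (Fin m) (fun _ => complexGaussian 1)
    fun _ => complexGaussian (σ ^ 2)).symm
  have h3 : HasLaw (MeasurableEquiv.arrowProdEquivProdArrow ℂ ℂ (Fin m)).symm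
      (Measure.pi fun _ : Fin m => channelNoise σ)
      ((Measure.pi fun _ : Fin m => complexGaussian 1).prod
        (Measure.pi fun _ : Fin m => complexGaussian (σ ^ 2))) :=
    ⟨h2.measurable.aemeasurable, h2.map_eq⟩
  exact h3.comp h1

/-- Independence makes the joint law a product, so that by Fubini the estimates for fixed U can be
integrated over the law of U. -/
theorem hasLaw_joint (H : IsReceiverModel P σ C v U e h w) :
    HasLaw (fun s => ((fun k j => U s k j), e s, fun k => (h s k, w s k)))
      ((spreadingLaw P U).prod ((P.map e).prod (Measure.pi fun _ : Fin m => channelNoise σ))) P := by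
  have hg := H.hasLaw_channel_noise
  have h1 : IndepFun e (fun s k => (h s k, w s k)) P :=
    H.indep_error.comp measurable_id measurable_zip
  have h2 : IndepFun (fun s (k j : Fin m) => U s k j)
      (fun s => (e s, fun k => (h s k, w s k))) P := by
    have h3 := H.indep_spreading.comp (φ := id)
      (ψ := fun y : (Fin m → ℂ) × (Fin m → ℂ) × (Fin m → ℂ) =>
        (y.1, fun k => (y.2.1 k, y.2.2 k))) measurable_id
      (measurable_fst.prodMk (measurable_zip.comp measurable_snd))
    exact h3
  have he := H.meas_error.aemeasurable (μ := P)
  refine ⟨H.measurable_spreading.aemeasurable.prodMk (he.prodMk hg.aemeasurable), ?_⟩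
  rw [(indepFun_iff_map_prod_eq_prod_map_map H.measurable_spreading.aemeasurable
    (he.prodMk hg.aemeasurable)).1 h2, (indepFun_iff_map_prod_eq_prod_map_map he
    hg.aemeasurable).1 h1, hg.map_eq, spreadingLaw]

theorem memLp_noiseSum_joint (H : IsReceiverModel P σ C v U e h w) (i : Fin m) :
    MemLp (fun y : (Fin m → Fin m → ℂ) × (Fin m → ℂ) × (Fin m → ℂ × ℂ) =>
      noiseSum (Matrix.of y.1) y.2.1 y.2.2 i) 2
      ((spreadingLaw P U).prod
        ((P.map e).prod (Measure.pi fun _ : Fin m => channelNoise σ))) := by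
  have := H.isProbabilityMeasure_spreadingLaw
  have : IsProbabilityMeasure (P.map e) :=
    Measure.isProbabilityMeasure_map H.meas_error.aemeasurable
  have hb := (H.error.map_law H.meas_error).bound
  simp only [noiseSum]
  refine memLp_finsetSum _ fun k _ => ?_
  have hA : MemLp (fun y : (Fin m → Fin m → ℂ) × (Fin m → ℂ) × (Fin m → ℂ × ℂ) =>
      channelTerm 1 0 (y.2.2 k)) 2 ((spreadingLaw P U).prod
        ((P.map e).prod (Measure.pi fun _ : Fin m => channelNoise σ))) :=
    (((memLp_channelTerm σ 1 0).comp_measurePreserving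
      (measurePreserving_eval (fun _ : Fin m => channelNoise σ) k)).comp_snd _).comp_snd _
  have hB : MemLp (fun y : (Fin m → Fin m → ℂ) × (Fin m → ℂ) × (Fin m → ℂ × ℂ) =>
      channelTerm 0 1 (y.2.2 k)) 2 ((spreadingLaw P U).prod
        ((P.map e).prod (Measure.pi fun _ : Fin m => channelNoise σ))) :=
    (((memLp_channelTerm σ 0 1).comp_measurePreserving
      (measurePreserving_eval (fun _ : Fin m => channelNoise σ) k)).comp_snd _).comp_snd _
  -- Almost surely the entries of U have modulus at most one and those of e at most C, hence |X_k| ≤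
  -- mC. This crude bound dominates the term by fixed square integrable functions.
  refine ((hA.norm.const_mul (∑ _j : Fin m, C)).add hB.norm).of_le ?_ ?_
  · refine Continuous.aestronglyMeasurable ?_
    simp only [channelTerm, Matrix.of_apply]
    fun_prop
  · have h1 := (Measure.quasiMeasurePreserving_fst (μ := spreadingLaw P U)
      (ν := (P.map e).prod (Measure.pi fun _ : Fin m => channelNoise σ))).ae H.ae_unitary
    have h2 := (Measure.quasiMeasurePreserving_snd (μ := spreadingLaw P U)
      (ν := (P.map e).prod (Measure.pi fun _ : Fin m => channelNoise σ))).ae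
      ((Measure.quasiMeasurePreserving_fst (μ := P.map e)
        (ν := Measure.pi fun _ : Fin m => channelNoise σ)).ae hb)
    filter_upwards [h1, h2] with y hy1 hy2
    have hsum : ‖∑ j, Matrix.of y.1 k j * y.2.1 j‖ ≤ ∑ _j : Fin m, C := by
      refine (norm_sum_le _ _).trans (Finset.sum_le_sum fun j _ => ?_)
      rw [norm_mul]
      calc _ ≤ 1 * ‖y.2.1 j‖ := by
            gcongr
            exact norm_entry_le_one hy1 k j
        _ ≤ _ := by rw [one_mul]; exact hy2 j
    have hdec : ∀ (a c : ℂ) (q : ℂ × ℂ), channelTerm a c q =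
        a * channelTerm 1 0 q + c * channelTerm 0 1 q := fun a c q => by
      simp only [channelTerm]; ring
    simp only [Pi.add_apply]
    rw [hdec]
    refine le_trans ((norm_add_le _ _).trans (add_le_add ?_ ?_)) (le_abs_self _)
    · rw [norm_mul, norm_mul, RCLike.norm_conj]
      gcongr
      calc _ ≤ 1 * ‖∑ j, Matrix.of y.1 k j * y.2.1 j‖ := by
            gcongr
            exact norm_entry_le_one hy1 k i
        _ ≤ _ := by rw [one_mul]; exact hsum
    · rw [norm_mul, RCLike.norm_conj]
      exact mul_le_of_le_one_left (norm_nonneg _) (norm_entry_le_one hy1 k i)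

theorem memLp_noiseSum (H : IsReceiverModel P σ C v U e h w) (i : Fin m) :
    MemLp (fun s => noiseSum (U s) (e s) (fun k => (h s k, w s k)) i) 2 P := by
  have h1 := H.memLp_noiseSum_joint i
  rw [← H.hasLaw_joint.map_eq] at h1
  exact (memLp_map_measure_iff h1.1 H.hasLaw_joint.aemeasurable).1 h1

theorem integral_eq_integral_joint {E : Type*} [NormedAddCommGroup E] [NormedSpace ℝ E]
    (H : IsReceiverModel P σ C v U e h w)
    {F : (Fin m → Fin m → ℂ) × (Fin m → ℂ) × (Fin m → ℂ × ℂ) → E}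
    (hF : Integrable F ((spreadingLaw P U).prod
      ((P.map e).prod (Measure.pi fun _ : Fin m => channelNoise σ)))) :
    ∫ s, F ((fun k j => U s k j), e s, fun k => (h s k, w s k)) ∂P =
      ∫ u, ∫ y, ∫ g, F (u, y, g) ∂(Measure.pi fun _ : Fin m => channelNoise σ) ∂(P.map e)
        ∂(spreadingLaw P U) := by
  have := H.isProbabilityMeasure_spreadingLaw
  have : IsProbabilityMeasure (P.map e) :=
    Measure.isProbabilityMeasure_map H.meas_error.aemeasurable
  have h1 : ∫ s, F ((fun k j => U s k j), e s, fun k => (h s k, w s k)) ∂P = _ :=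
    H.hasLaw_joint.integral_comp hF.aestronglyMeasurable
  rw [h1, integral_prod _ hF]
  refine integral_congr_ae ?_
  filter_upwards [hF.prod_right_ae] with u hu
  exact integral_prod _ hu

theorem integral_noiseSum_eq_zero (H : IsReceiverModel P σ C v U e h w) (i : Fin m) :
    ∫ s, noiseSum (U s) (e s) (fun k => (h s k, w s k)) i ∂P = 0 := by
  have := H.isProbabilityMeasure_spreadingLaw
  have hi := (H.memLp_noiseSum_joint i).integrable one_le_two
  refine (H.integral_eq_integral_joint hi).trans ?_
  simp only [integral_noiseSum, integral_zero]

theorem integral_norm_sq_noiseSum_eq (H : IsReceiverModel P σ C v U e h w) (i : Fin m) :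
    ∫ s, ‖noiseSum (U s) (e s) (fun k => (h s k, w s k)) i‖ ^ 2 ∂P = v + σ ^ 2 := by
  have := H.isProbabilityMeasure_spreadingLaw
  have : IsProbabilityMeasure (P.map e) :=
    Measure.isProbabilityMeasure_map H.meas_error.aemeasurable
  have hL := H.memLp_noiseSum_joint i
  refine (H.integral_eq_integral_joint ((memLp_two_iff_integrable_sq_norm hL.1).1 hL)).trans ?_
  have h1 : ∀ᵐ u ∂(spreadingLaw P U), ∫ y, ∫ g, ‖noiseSum (Matrix.of u) y g i‖ ^ 2
      ∂(Measure.pi fun _ : Fin m => channelNoise σ) ∂(P.map e) = v + σ ^ 2 := by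
    filter_upwards [H.ae_unitary] with u hu
    exact integral_integral_norm_sq_noiseSum (H.error.map_law H.meas_error) hu σ i
  rw [integral_congr_ae h1]
  simp

/-- Bound on the characteristic function of finitely many entries of the noise term. -/
theorem norm_integral_cexp_sub_le [NeZero m] (H : IsReceiverModel P σ C v U e h w)
    (hproper : (∀ j, ∫ s, e s j ^ 2 ∂P = 0) ∨ ∀ᵐ s ∂P, U s = dftMatrix m) {δ : ℝ} (hδ : 0 ≤ δ)
    {p : ℕ} (I : Fin p ↪ Fin m) (τ : Fin p → ℂ) :
    ‖∫ s, Complex.exp ((∑ a, τ a * noiseSum (U s) (e s) (fun k => (h s k, w s k)) (I a)).re *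
        Complex.I) ∂P - Complex.exp (-(((v + σ ^ 2) / 4 * ∑ a, ‖τ a‖ ^ 2 : ℝ) : ℂ))‖ ≤
      charBound C σ τ * δ + C ^ 2 * (∑ a, ‖τ a‖) ^ 2 / m +
        2 * P.real {s | ∃ k j, δ ≤ ‖U s k j‖} := by
  have := H.isProbabilityMeasure_spreadingLaw
  have : IsProbabilityMeasure (P.map e) :=
    Measure.isProbabilityMeasure_map H.meas_error.aemeasurable
  have hμ := H.error.map_law H.meas_error
  have hv : 0 ≤ v := hμ.var_nonneg
  set ν := Measure.pi fun _ : Fin m => channelNoise σ with hν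
  set c := Complex.exp (-(((v + σ ^ 2) / 4 * ∑ a, ‖τ a‖ ^ 2 : ℝ) : ℂ)) with hc
  have hc1 : ‖c‖ ≤ 1 := norm_cexp_neg_le_one (by positivity)
  set F : (Fin m → Fin m → ℂ) × (Fin m → ℂ) × (Fin m → ℂ × ℂ) → ℂ := fun y =>
    Complex.exp ((∑ a, τ a * noiseSum (Matrix.of y.1) y.2.1 y.2.2 (I a)).re * Complex.I) with hF
  have hF1 : ∀ y, ‖F y‖ ≤ 1 := fun y => by rw [hF, Complex.norm_exp_ofReal_mul_I]
  have hFc : Continuous F := by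
    have := fun a => continuous_noiseSum (m := m) (I a)
    fun_prop
  have hFi : Integrable F ((spreadingLaw P U).prod ((P.map e).prod ν)) :=
    Integrable.of_bound hFc.aestronglyMeasurable 1 (ae_of_all _ hF1)
  set ψ : (Fin m → Fin m → ℂ) → ℂ := fun u => ∫ y, ∫ g, F (u, y, g) ∂ν ∂(P.map e) with hψ
  have hψ1 : ∀ u, ‖ψ u‖ ≤ 1 := fun u => by
    refine (norm_integral_le_of_norm_le_const (C := 1) (ae_of_all _ fun y => ?_)).trans (by simp)
    exact (norm_integral_le_of_norm_le_const (C := 1) (ae_of_all _ fun g => hF1 _)).trans (by simp)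
  have hint : ∫ s, Complex.exp ((∑ a, τ a * noiseSum (U s) (e s) (fun k => (h s k, w s k))
      (I a)).re * Complex.I) ∂P = ∫ u, ψ u ∂(spreadingLaw P U) := H.integral_eq_integral_joint hFi
  have hψi : Integrable ψ (spreadingLaw P U) := by
    refine hFi.integral_prod_left.congr ?_
    filter_upwards [hFi.prod_right_ae] with u hu
    exact integral_prod _ hu
  set bad : Set (Fin m → Fin m → ℂ) := {u | ∃ k j, δ ≤ ‖u k j‖} with hbad
  have hbadm : MeasurableSet bad := by
    have : bad = ⋃ k, ⋃ j, {u | δ ≤ ‖u k j‖} := by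
      ext u; simp [hbad]
    rw [this]
    refine MeasurableSet.iUnion fun k => MeasurableSet.iUnion fun j => ?_
    exact measurableSet_le measurable_const (by fun_prop)
  have hprop' : (∀ j, ∫ y, y j ^ 2 ∂(P.map e) = 0) ∨
      ∀ᵐ u ∂(spreadingLaw P U), Matrix.of u = dftMatrix m := by
    refine hproper.imp (fun h0 j => ?_) fun h0 => ?_
    · rw [integral_map H.meas_error.aemeasurable
        ((measurable_pi_apply j).pow_const 2).aestronglyMeasurable]
      exact h0 j
    · have hms : MeasurableSet {u : Fin m → Fin m → ℂ | Matrix.of u = dftMatrix m} := by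
        have : {u : Fin m → Fin m → ℂ | Matrix.of u = dftMatrix m} =
            {fun k j => dftMatrix m k j} := by
          ext u
          exact ⟨fun hu => congrArg Matrix.of.symm hu, fun hu => congrArg Matrix.of hu⟩
        rw [this]
        exact measurableSet_singleton _
      rw [spreadingLaw, ae_map_iff H.measurable_spreading.aemeasurable hms]
      exact h0
  have hprop'' : ∀ᵐ u ∂(spreadingLaw P U), (∀ j, ∫ y, y j ^ 2 ∂(P.map e) = 0) ∨
      Matrix.of u = dftMatrix m := by
    rcases hprop' with h0 | h0
    · exact ae_of_all _ fun u => Or.inl h0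
    · exact h0.mono fun u hu => Or.inr hu
  set B := charBound C σ τ * δ + C ^ 2 * (∑ a, ‖τ a‖) ^ 2 / m with hB
  have hcb : 0 ≤ charBound C σ τ := by unfold charBound; positivity
  have hB0 : 0 ≤ B := by positivity
  -- Off `bad` all entries are below δ and the bound for fixed spreading applies; on `bad` two
  -- numbers of modulus at most one differ by at most 2.
  have hpt : ∀ᵐ u ∂(spreadingLaw P U), ‖ψ u - c‖ ≤ B + bad.indicator (fun _ => 2) u := by
    filter_upwards [H.ae_unitary, hprop''] with u hu hpu
    by_cases hub : u ∈ bad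
    · rw [Set.indicator_of_mem hub]
      have := (norm_sub_le (ψ u) c).trans (add_le_add (hψ1 u) hc1)
      linarith
    · rw [Set.indicator_of_notMem hub, add_zero]
      have hle : ∀ k j, ‖Matrix.of u k j‖ ≤ δ := fun k j => by
        by_contra hlt
        exact hub ⟨k, j, (not_le.1 hlt).le⟩
      exact norm_integral_cexp_noiseSum_sub_le hμ hu hpu hle I τ
  have hsub : ∫ u, ψ u ∂(spreadingLaw P U) - c = ∫ u, (ψ u - c) ∂(spreadingLaw P U) := by
    rw [integral_sub hψi (integrable_const _)]
    simp
  have hi2 : Integrable (bad.indicator fun _ => (2 : ℝ)) (spreadingLaw P U) :=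
    (integrable_const _).indicator hbadm
  rw [hint, hsub]
  refine (norm_integral_le_of_norm_le ((integrable_const B).add hi2) hpt).trans_eq ?_
  have hreal : (spreadingLaw P U).real bad = P.real {s | ∃ k j, δ ≤ ‖U s k j‖} := by
    rw [measureReal_def, spreadingLaw, Measure.map_apply H.measurable_spreading hbadm]
    rfl
  simp only [Pi.add_apply]
  rw [integral_add (integrable_const B) hi2, integral_indicator_const _ hbadm, hreal]
  simp [mul_comm]

end IsReceiverModel

end Receiver

/-! ### From characteristic functions to merging of laws -/

section WeakMerging

variable {p : ℕ}

/-- Characteristic functions require an inner product, hence the passage from the product space to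
`PiLp 2`. -/
theorem charFun_map_toLp (μ : Measure (Fin p → ℂ)) (t : PiLp 2 fun _ : Fin p => ℂ) :
    charFun (μ.map (WithLp.toLp 2)) t =
      ∫ z, Complex.exp ((∑ a, starRingEnd ℂ (z a) * t a).re * Complex.I) ∂μ := by
  rw [charFun_apply, ← MeasurableEquiv.coe_toLp, integral_map_equiv]
  congr 1
  ext z
  rw [PiLp.inner_apply, Complex.re_sum]
  simp only [MeasurableEquiv.coe_toLp, Complex.inner, mul_comm]

theorem charFun_pi_complexGaussian {v : ℝ} (hv : 0 ≤ v) (t : PiLp 2 fun _ : Fin p => ℂ) :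
    charFun ((Measure.pi fun _ : Fin p => complexGaussian v).map (WithLp.toLp 2)) t =
      Complex.exp (-((v / 4 * ∑ a, ‖t a‖ ^ 2 : ℝ) : ℂ)) := by
  rw [charFun_pi]
  simp_rw [charFun_complexGaussian hv]
  rw [← Complex.exp_sum]
  congr 1
  rw [Finset.sum_neg_distrib]
  push_cast
  rw [Finset.mul_sum]
  congr 1
  exact Finset.sum_congr rfl fun a _ => by ring

theorem tendsto_integral_of_tendsto_charFun {μ : ℕ → Measure (Fin p → ℂ)}
    [∀ k, IsProbabilityMeasure (μ k)] {ν : Measure (Fin p → ℂ)} [IsProbabilityMeasure ν]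
    (h : ∀ t : PiLp 2 fun _ : Fin p => ℂ, Tendsto
      (fun k => charFun ((μ k).map (WithLp.toLp 2)) t) atTop
      (𝓝 (charFun (ν.map (WithLp.toLp 2)) t))) (f : (Fin p → ℂ) →ᵇ ℝ) :
    Tendsto (fun k => ∫ z, f z ∂(μ k)) atTop (𝓝 (∫ z, f z ∂ν)) := by
  have hm : Measurable (WithLp.toLp 2 : (Fin p → ℂ) → PiLp 2 fun _ : Fin p => ℂ) :=
    (MeasurableEquiv.toLp 2 (Fin p → ℂ)).measurable
  have hp : ∀ k, IsProbabilityMeasure ((μ k).map (WithLp.toLp 2)) := fun k =>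
    Measure.isProbabilityMeasure_map hm.aemeasurable
  have hpν : IsProbabilityMeasure (ν.map (WithLp.toLp 2)) :=
    Measure.isProbabilityMeasure_map hm.aemeasurable
  have h1 := ProbabilityMeasure.tendsto_of_tendsto_charFun
    (μ := fun k => ⟨(μ k).map (WithLp.toLp 2), hp k⟩) (μ₀ := ⟨ν.map (WithLp.toLp 2), hpν⟩) h
  have h2 := ProbabilityMeasure.tendsto_iff_forall_integral_tendsto.1 h1
    (f.compContinuous ⟨WithLp.ofLp, PiLp.continuous_ofLp 2 _⟩)
  have h3 : ∀ ρ : Measure (Fin p → ℂ), ∫ y, f (WithLp.ofLp y) ∂(ρ.map (WithLp.toLp 2)) =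
      ∫ z, f z ∂ρ := fun ρ => by
    rw [← MeasurableEquiv.coe_toLp, integral_map_equiv]
    rfl
  have h4 : (fun k => ∫ z, f z ∂(μ k)) =
      fun k => ∫ y, f (WithLp.ofLp y) ∂((μ k).map (WithLp.toLp 2)) := funext fun k => (h3 _).symm
  rw [h4, ← h3 ν]
  exact h2

/-- The Gaussian target moves with k, so Lévy's theorem does not apply directly. By compactness
every subsequence has a further one along which the variances converge, and there both laws tend to
the same Gaussian. -/
theorem tendsto_integral_sub_integral_complexGaussian {μ : ℕ → Measure (Fin p → ℂ)}
    [∀ k, IsProbabilityMeasure (μ k)] {v : ℕ → ℝ} {B : ℝ} (hv : ∀ k, v k ∈ Set.Icc 0 B)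
    (h : ∀ t : Fin p → ℂ, Tendsto (fun k =>
      (∫ z, Complex.exp ((∑ a, starRingEnd ℂ (z a) * t a).re * Complex.I) ∂(μ k)) -
        Complex.exp (-((v k / 4 * ∑ a, ‖t a‖ ^ 2 : ℝ) : ℂ))) atTop (𝓝 0))
    (f : (Fin p → ℂ) →ᵇ ℝ) :
    Tendsto (fun k => (∫ z, f z ∂(μ k)) -
      ∫ z, f z ∂(Measure.pi fun _ : Fin p => complexGaussian (v k))) atTop (𝓝 0) := by
  refine tendsto_of_subseq_tendsto fun ns hns => ?_
  obtain ⟨v₀, hv₀, φ, hφ, hlim⟩ := isCompact_Icc.tendsto_subseq fun k => hv (ns k)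
  refine ⟨φ, ?_⟩
  have hsub : Tendsto (fun k => ns (φ k)) atTop atTop := hns.comp hφ.tendsto_atTop
  have hexp : ∀ t : PiLp 2 fun _ : Fin p => ℂ, Tendsto (fun k =>
      Complex.exp (-((v (ns (φ k)) / 4 * ∑ a, ‖t a‖ ^ 2 : ℝ) : ℂ))) atTop
      (𝓝 (Complex.exp (-((v₀ / 4 * ∑ a, ‖t a‖ ^ 2 : ℝ) : ℂ)))) := fun t => by
    have hc : Continuous fun r : ℝ => Complex.exp (-((r / 4 * ∑ a, ‖t a‖ ^ 2 : ℝ) : ℂ)) := by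
      fun_prop
    exact (hc.tendsto v₀).comp hlim
  have h1 := tendsto_integral_of_tendsto_charFun (μ := fun k => μ (ns (φ k)))
    (ν := Measure.pi fun _ : Fin p => complexGaussian v₀) (fun t => by
      simp_rw [charFun_map_toLp]
      rw [← charFun_map_toLp, charFun_pi_complexGaussian hv₀.1]
      have := ((h t).comp hsub).add (hexp t)
      simpa using this) f
  have h2 := tendsto_integral_of_tendsto_charFun
    (μ := fun k => Measure.pi fun _ : Fin p => complexGaussian (v (ns (φ k))))
    (ν := Measure.pi fun _ : Fin p => complexGaussian v₀) (fun t => by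
      simp_rw [fun k => charFun_pi_complexGaussian (p := p) (hv (ns (φ k))).1 t]
      rw [charFun_pi_complexGaussian hv₀.1]
      exact hexp t) f
  simpa using h1.sub h2

end WeakMerging

/-! ### Limits uniform in the choice of entries -/

section Asymptotics

variable {Ω : ℕ → Type*} [∀ n, MeasurableSpace (Ω n)] {P : ∀ n, Measure (Ω n)}
  [∀ n, IsProbabilityMeasure (P n)] {M : ℕ → ℕ} {σ C : ℝ} {v : ℕ → ℝ}
  {U : ∀ n, Ω n → Matrix (Fin (M n)) (Fin (M n)) ℂ} {e h w : ∀ n, Ω n → Fin (M n) → ℂ}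

theorem eventually_norm_integral_cexp_sub_lt (hM : Tendsto M atTop atTop)
    (H : ∀ n, IsReceiverModel (P n) σ C (v n) (U n) (e n) (h n) (w n))
    (hspread : ∀ ε : ℝ, 0 < ε → Tendsto (fun n => P n {s | ∃ k j, ε ≤ ‖U n s k j‖}) atTop (𝓝 0))
    (hproper : ∀ n, (∀ j, ∫ s, e n s j ^ 2 ∂(P n) = 0) ∨ ∀ᵐ s ∂(P n), U n s = dftMatrix (M n))
    {p : ℕ} (τ : Fin p → ℂ) {ε : ℝ} (hε : 0 < ε) :
    ∀ᶠ n in atTop, ∀ I : Fin p ↪ Fin (M n),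
      ‖∫ s, Complex.exp ((∑ a, τ a * noiseSum (U n s) (e n s) (fun k => (h n s k, w n s k))
          (I a)).re * Complex.I) ∂(P n) -
        Complex.exp (-(((v n + σ ^ 2) / 4 * ∑ a, ‖τ a‖ ^ 2 : ℝ) : ℂ))‖ < ε := by
  have hcb : 0 ≤ charBound C σ τ := by unfold charBound; positivity
  -- The threshold δ is fixed before n, so that the part linear in δ stays below ε/2; the other two
  -- parts vanish as n grows. The added 1 avoids a zero denominator.
  set δ := ε / 2 / (charBound C σ τ + 1) with hδ
  have hδ0 : 0 < δ := by positivity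
  have hcbδ : charBound C σ τ * δ < ε / 2 := by
    rw [hδ, mul_div_assoc', div_lt_iff₀ (by positivity)]
    nlinarith
  have h1 : Tendsto (fun n => C ^ 2 * (∑ a, ‖τ a‖) ^ 2 / (M n : ℝ)) atTop (𝓝 0) :=
    tendsto_const_nhds.div_atTop (tendsto_natCast_atTop_atTop.comp hM)
  have h2 : Tendsto (fun n => 2 * (P n).real {s | ∃ k j, δ ≤ ‖U n s k j‖}) atTop (𝓝 0) := by
    have := (ENNReal.tendsto_toReal ENNReal.zero_ne_top).comp (hspread δ hδ0)
    simpa [measureReal_def] using this.const_mul 2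
  have h3 := h1.add h2
  rw [add_zero] at h3
  filter_upwards [h3.eventually_lt_const (half_pos hε), hM.eventually_ge_atTop 1] with n hn hMn I
  have : NeZero (M n) := ⟨by omega⟩
  refine ((H n).norm_integral_cexp_sub_le (hproper n) hδ0.le I τ).trans_lt ?_
  linarith

theorem asymptoticallyIIDComplexNormal_noiseSum (hM : Tendsto M atTop atTop)
    (H : ∀ n, IsReceiverModel (P n) σ C (v n) (U n) (e n) (h n) (w n))
    (hspread : ∀ ε : ℝ, 0 < ε → Tendsto (fun n => P n {s | ∃ k j, ε ≤ ‖U n s k j‖}) atTop (𝓝 0))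
    (hproper : ∀ n, (∀ j, ∫ s, e n s j ^ 2 ∂(P n) = 0) ∨ ∀ᵐ s ∂(P n), U n s = dftMatrix (M n))
    (hv : ∀ n, v n ∈ Set.Icc 0 (C ^ 2)) :
    AsymptoticallyIIDComplexNormal P M
      (fun n s => noiseSum (U n s) (e n s) fun k => (h n s k, w n s k)) fun n => v n + σ ^ 2 := by
  intro p f ε hε
  -- Uniformity in the entries: if it failed, offending choices could be picked along a subsequence.
  -- The characteristic function bound is uniform in the choice, so merging holds along it as well,
  -- a contradiction.
  by_contra hcon
  rw [not_eventually] at hcon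
  obtain ⟨φ, hφ, hφI⟩ := extraction_of_frequently_atTop hcon
  simp only [not_forall, not_lt] at hφI
  choose I hI using hφI
  set z : ∀ k, Ω (φ k) → Fin p → ℂ := fun k s a => noiseSum (U (φ k) s) (e (φ k) s)
    (fun i => (h (φ k) s i, w (φ k) s i)) (I k a) with hz
  have hzm : ∀ k, AEMeasurable (z k) (P (φ k)) := fun k =>
    aemeasurable_pi_lambda _ fun a => ((H (φ k)).memLp_noiseSum (I k a)).1.aemeasurable
  have hprob : ∀ k, IsProbabilityMeasure ((P (φ k)).map (z k)) := fun k =>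
    Measure.isProbabilityMeasure_map (hzm k)
  have hlim := tendsto_integral_sub_integral_complexGaussian (μ := fun k => (P (φ k)).map (z k))
    (v := fun k => v (φ k) + σ ^ 2) (B := C ^ 2 + σ ^ 2)
    (fun k => ⟨by have := (hv (φ k)).1; positivity, by have := (hv (φ k)).2; linarith⟩)
    (fun t => by
      rw [Metric.tendsto_nhds]
      intro η hη
      have h1 := hφ.tendsto_atTop.eventually (eventually_norm_integral_cexp_sub_lt hM H hspread
        -- The inner product conjugates z, and Re(conj(z) t) = Re(conj(t) z).
        hproper (fun a => starRingEnd ℂ (t a)) hη)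
      filter_upwards [h1] with k hk
      rw [dist_zero_right]
      have h2 := hk (I k)
      simp only [RCLike.norm_conj] at h2
      rw [integral_map (hzm k) (Continuous.aestronglyMeasurable (by fun_prop))]
      refine lt_of_eq_of_lt ?_ h2
      congr 2
      refine integral_congr_ae (ae_of_all _ fun s => ?_)
      simp only
      congr 3
      simp only [Complex.re_sum, hz]
      refine Finset.sum_congr rfl fun a _ => ?_
      simp only [Complex.mul_re, Complex.conj_re, Complex.conj_im]
      ring) f
  rw [Metric.tendsto_nhds] at hlim
  obtain ⟨k, hk⟩ := (hlim ε hε).exists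
  rw [dist_zero_right, Real.norm_eq_abs,
    integral_map (hzm k) f.continuous.aestronglyMeasurable] at hk
  exact absurd hk (not_lt.2 (hI k))

end Asymptotics

end ThresholdingDFE

theorem theorem1
    {Ω : ℕ → Type*} [∀ n, MeasurableSpace (Ω n)]
    (P : ∀ n, Measure (Ω n)) [∀ n, IsProbabilityMeasure (P n)]
    -- block lengths tending to infinity, constellation, noise standard deviation
    (M : ℕ → ℕ) (hM : Tendsto M atTop atTop) (S : Finset ℂ) (σ : ℝ) (hσ : 0 ≤ σ)
    -- channel, spreading matrix, transmitted vector, initial detected vector, additive noise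
    (h : ∀ n, Ω n → Fin (M n) → ℂ)
    (U : ∀ n, Ω n → Matrix (Fin (M n)) (Fin (M n)) ℂ)
    (x xhat : ∀ n, Ω n → Fin (M n) → ℂ)
    (w : ∀ n, Ω n → Fin (M n) → ℂ)
    -- normalized Rayleigh fading and white Gaussian noise
    (hh : ∀ n, HasLaw (h n) (Measure.pi fun _ : Fin (M n) => ThresholdingDFE.complexGaussian 1)
      (P n))
    (hw : ∀ n, HasLaw (w n)
      (Measure.pi fun _ : Fin (M n) => ThresholdingDFE.complexGaussian (σ ^ 2)) (P n))
    -- unitary spreading whose entries are uniformly small, in probability, as the size grows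
    (hUmeas : ∀ n k j, Measurable fun s => U n s k j)
    (hUunit : ∀ n, ∀ᵐ s ∂(P n), U n s ∈ Matrix.unitaryGroup (Fin (M n)) ℂ)
    (hUspread : ∀ ε : ℝ, 0 < ε →
      Tendsto (fun n => P n {s | ∃ k j, ε ≤ ‖U n s k j‖}) atTop (𝓝 0))
    -- symbols from the constellation
    (hxmeas : ∀ n, Measurable (x n)) (hxhatmeas : ∀ n, Measurable (xhat n))
    (hxS : ∀ n, ∀ᵐ s ∂(P n), ∀ j, x n s j ∈ S)
    (hxhatS : ∀ n, ∀ᵐ s ∂(P n), ∀ j, xhat n s j ∈ S)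
    -- the error signal `x - xhat`: independent entries, zero mean, common variance
    (heindep : ∀ n, iIndepFun (fun j s => (x n s - xhat n s) j) (P n))
    (hemean : ∀ n j, ∫ s, (x n s - xhat n s) j ∂(P n) = 0)
    (hevar : ∀ n j, ∫ s, ‖(x n s - xhat n s) j‖ ^ 2 ∂(P n) =
      ThresholdingDFE.meanEnergy (P n) (fun s => x n s - xhat n s) / (M n : ℝ))
    -- the errors have vanishing pseudo-variance, or the spreading matrix is the DFT matrix
    (heproper : ∀ n, (∀ j, ∫ s, ((x n s - xhat n s) j) ^ 2 ∂(P n) = 0) ∨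
      (∀ᵐ s ∂(P n), U n s = ThresholdingDFE.dftMatrix (M n)))
    -- mutual independence of the spreading, the error signal, the channel and the noise
    (hind₁ : ∀ n, IndepFun (fun s (k j : Fin (M n)) => U n s k j)
      (fun s => (x n s - xhat n s, h n s, w n s)) (P n))
    (hind₂ : ∀ n, IndepFun (fun s => x n s - xhat n s) (fun s => (h n s, w n s)) (P n))
    (hind₃ : ∀ n, IndepFun (h n) (w n) (P n)) :
    (∀ n i,
      MemLp (fun s => ThresholdingDFE.noiseTerm (h n s) (U n s) (x n s) (xhat n s) (w n s) i) 2
        (P n) ∧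
      ∫ s, ThresholdingDFE.noiseTerm (h n s) (U n s) (x n s) (xhat n s) (w n s) i ∂(P n) = 0 ∧
      ∫ s, ‖ThresholdingDFE.noiseTerm (h n s) (U n s) (x n s) (xhat n s) (w n s) i‖ ^ 2 ∂(P n) =
        ThresholdingDFE.meanEnergy (P n) (fun s => x n s - xhat n s) / (M n : ℝ) + σ ^ 2) ∧
    ThresholdingDFE.AsymptoticallyIIDComplexNormal P M
      (fun n s => ThresholdingDFE.noiseTerm (h n s) (U n s) (x n s) (xhat n s) (w n s))
      (fun n => ThresholdingDFE.meanEnergy (P n) (fun s => x n s - xhat n s) / (M n : ℝ) +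
        σ ^ 2) := by
  -- The sum of all moduli is a crude substitute for the largest one; only a bound on the errors
  -- that does not depend on n matters.
  set C : ℝ := 2 * ∑ a ∈ S, ‖a‖ with hC
  have hmeas : ∀ n, Measurable fun s => x n s - xhat n s := fun n => (hxmeas n).sub (hxhatmeas n)
  have hbound : ∀ n, ∀ᵐ s ∂(P n), ∀ j, ‖(x n s - xhat n s) j‖ ≤ C := fun n => by
    filter_upwards [hxS n, hxhatS n] with s h1 h2 j
    have hle : ∀ a ∈ S, ‖a‖ ≤ ∑ a ∈ S, ‖a‖ := fun a ha =>
      Finset.single_le_sum (f := fun a => ‖a‖) (fun _ _ => norm_nonneg _) ha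
    refine (norm_sub_le _ _).trans ?_
    linarith [hle _ (h1 j), hle _ (h2 j)]
  have H : ∀ n, ThresholdingDFE.IsReceiverModel (P n) σ C
      (ThresholdingDFE.meanEnergy (P n) (fun s => x n s - xhat n s) / (M n : ℝ)) (U n)
      (fun s => x n s - xhat n s) (h n) (w n) := fun n =>
    { law_channel := hh n
      law_noise := hw n
      meas_spreading := hUmeas n
      unitary := hUunit n
      meas_error := hmeas n
      error :=
        { indep := heindep n
          meas := fun j => (measurable_pi_apply j).comp (hmeas n)
          bound := hbound n
          mean := hemean n
          var := hevar n }
      indep_spreading := hind₁ n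
      indep_error := hind₂ n
      indep_noise := hind₃ n }
  have hz : ∀ n, ∀ᵐ s ∂(P n), ThresholdingDFE.noiseTerm (h n s) (U n s) (x n s) (xhat n s) (w n s) =
      ThresholdingDFE.noiseSum (U n s) (x n s - xhat n s) fun k => (h n s k, w n s k) := fun n => by
    filter_upwards [hUunit n] with s hs
    exact funext fun i => ThresholdingDFE.noiseTerm_eq_noiseSum hs _ _ _ _ i
  have hv : ∀ n, ThresholdingDFE.meanEnergy (P n) (fun s => x n s - xhat n s) / (M n : ℝ) ∈
      Set.Icc 0 (C ^ 2) := fun n => by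
    -- For an empty block the variance is a quotient by zero, hence 0, and there is no entry from
    -- which to read off the bounds.
    rcases Nat.eq_zero_or_pos (M n) with h0 | h0
    · have h1 : (M n : ℝ) = 0 := by exact_mod_cast h0
      rw [h1, div_zero]
      exact ⟨le_rfl, sq_nonneg C⟩
    · have : Nonempty (Fin (M n)) := ⟨⟨0, h0⟩⟩
      exact ⟨(H n).error.var_nonneg, (H n).error.var_le_sq⟩
  refine ⟨fun n i => ⟨?_, ?_, ?_⟩, fun p f ε hε => ?_⟩
  · exact ((H n).memLp_noiseSum i).ae_eq ((hz n).mono fun s hs => (congrFun hs i).symm)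
  · rw [integral_congr_ae ((hz n).mono fun s hs => congrFun hs i)]
    exact (H n).integral_noiseSum_eq_zero i
  · rw [integral_congr_ae ((hz n).mono fun s hs => congrArg (fun y => ‖y i‖ ^ 2) hs)]
    exact (H n).integral_norm_sq_noiseSum_eq i
  · filter_upwards [ThresholdingDFE.asymptoticallyIIDComplexNormal_noiseSum hM H hUspread heproper
      hv p f ε hε] with n hn I
    rw [integral_congr_ae ((hz n).mono fun s hs => congrArg (fun y => f fun a => y (I a)) hs)]
    exact hn I
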